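/- Let $\mathcal R$ and $\mathcal B$ be independent homogeneous Poisson processes on $\mathbb R$ with the same finite intensity $\lambda>0$, whose points are called red and blue, respectively. A stable two-color multi-matching with all degrees equal to $2$ is a simple bipartite graph on the red and blue points in which every edge joins a red point and a blue point, every point has degree exactly $2$, and, for every red point $x$ and every blue point $y$, either $x$ and $y$ are joined by an edge or at least one of $x$ and $y$ has no incident edge longer than $|x-y|$. Then, almost surely, there is exactly one such graph, and it has no infinite connected component. -/

import Mathlib

open MeasureTheory ProbabilityTheory
open scoped ENNReal NNReal

/-- `N` is a homogeneous Poisson process on `ℝ` with intensity `lam`, realized as a random measure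
on the probability space `(Ω, P)`: the number of points in a Borel set `A` of finite length is
Poisson distributed with mean `lam * |A|`, and the numbers of points in disjoint Borel sets are
independent. -/
structure IsPoissonProcess {Ω : Type*} [MeasurableSpace Ω] (P : Measure Ω) (lam : ℝ≥0)
    (N : Ω → Measure ℝ) : Prop where
  measurable : Measurable N
  hasLaw : ∀ A : Set ℝ, MeasurableSet A → volume A ≠ ∞ →
    P.map (fun ω => N ω A) =
      (poissonMeasure (lam * (volume A).toNNReal)).map (fun n : ℕ => (n : ℝ≥0∞))
  indep : ∀ (n : ℕ) (A : Fin n → Set ℝ), (∀ i, MeasurableSet (A i)) →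
    (∀ i j, i ≠ j → Disjoint (A i) (A j)) → iIndepFun (fun i ω => N ω (A i)) P

/-- The point set `[N]` of a point measure: the set of its atoms. -/
def pointSet (N : Measure ℝ) : Set ℝ := {x | 0 < N {x}}

/-- `G` is a two-color multi-matching of the red points `R` and the blue points `B`: every edge
joins a red and a blue point, each red point `x` has degree `X x`, and each blue point `y` has
degree `Y y`.  The graph lives on all of `ℝ`; reals outside `R ∪ B` are isolated, so that
they do not affect the components of the graph on `R ∪ B`. -/
structure IsMultiMatching (R B : Set ℝ) (X Y : ℝ → ℕ) (G : SimpleGraph ℝ) : Prop where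
  bipartite : ∀ x y, G.Adj x y → (x ∈ R ∧ y ∈ B) ∨ (x ∈ B ∧ y ∈ R)
  degree_red : ∀ x ∈ R, (G.neighborSet x).encard = X x
  degree_blue : ∀ y ∈ B, (G.neighborSet y).encard = Y y

/-- A two-color multi-matching is stable if any red point `x` and blue point `y` are either linked
by an edge, or at least one of them has no incident edge longer than `|x - y|`. -/
structure IsStableMultiMatching (R B : Set ℝ) (X Y : ℝ → ℕ) (G : SimpleGraph ℝ) : Prop extends
    IsMultiMatching R B X Y G where
  stable : ∀ x ∈ R, ∀ y ∈ B, x ≠ y →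
    G.Adj x y ∨ (∀ z, G.Adj x z → |x - z| ≤ |x - y|) ∨ (∀ z, G.Adj y z → |y - z| ≤ |x - y|)

/-!
A deterministic argument, for pairs `R`, `B` of subsets of the line with the almost sure properties
collected in `WellSpread`, is combined with a proof of these properties for Poisson processes.

*Existence and uniqueness.* Empty intervals of arbitrary length on both sides of every point
confine each chain of red-blue pairs with decreasing distances, in which consecutive pairs share a
point, to a bounded set; so the relation "closer and with a common point" between pairs is well
founded (`Precedes`). At a minimal pair on which two stable multi-matchings differ, one of them
would be unstable, whence uniqueness. By recursion, linking a pair when neither of its members has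
two links to closer points, one obtains a graph `GreedyStable` of maximal degree two, in which a
point of smaller degree is still open to any partner. This is the required graph once all degrees
are seen to be two.

*Long edges.* By stability, two edges that cross are joined by a third one
(`WeaklyStable.adj_of_cross`). As degrees are at most two, it follows that if two edges with red
left ends pass over every point of an interval, a single edge passes over the whole interval
(`WeaklyStable.exists_long_edge`). The walk that steps up at red and down at blue points makes
excursions: at some arbitrarily large scales `L` it stays above any given level at all distances
between `L` and `4 * L` from the origin, on both sides, and likewise below any given level
(`WellSpread.exc_red`, `WellSpread.exc_blue`). An excess of one color, when the points of this color
have degree two, makes edges leave the interval counted, hence produces a long edge that starts near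
the origin. A red point of degree less than two in the greedy graph would force all blue points not
adjacent to it to have degree two and edges shorter than their distance to it, against the
existence of a long edge from such a point; so every degree is two.

*Finite components.* An infinite component contains a bi-infinite path. By planarity, if an edge of
the graph passes over a vertex of an infinite component, one end of the edge is adjacent to this
vertex (`WeaklyStable.adj_of_straddle`), and the walk is almost constant along the component
(`FullyStable.walk_sub_le`). So the path jumps over the zone of an excursion of the walk, and the
two edges by which it leaves `[-L, L]` have ends beyond distance `4 * L`; the excess of red points
forces these edges to start at a red point if they lead to the right, and at a blue point if they
lead to the left. If both lead to the same side, one of them passes over the start of the other,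
and the straddling lemma makes this start adjacent to an end of the first; if they lead to
different sides, stability makes the two starts adjacent. Both are impossible, as the starts have
the same color in the former case and adjacent points are consecutive on the path
(`FullyStable.finite_component`).

*Probability.* The numbers of points in unit cells are independent and identically distributed. By
the central limit theorem and Kolmogorov's maximal inequality, the walk makes an excursion of a
given scale simultaneously on both sides with probability bounded below, and the zero-one law turns
this into almost surely infinitely many scales (`ae_exists_altSum_ge`). Empty intervals come from
the second Borel–Cantelli lemma; simplicity of the processes and the absence of common points and
ties come from union bounds over meshes of vanishing width.
-/

/-! ### Weakly stable bipartite graphs on the line -/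

/-- A bipartite graph on the disjoint point sets `R` and `B`, with all degrees at most two, in which
a red and a blue point that both have an edge longer than their distance are joined.  Unlike in a
stable multi-matching, points of degree less than two put no demand on the graph. -/
structure WeaklyStable (R B : Set ℝ) (G : SimpleGraph ℝ) : Prop where
  disj : Disjoint R B
  bip : ∀ x y, G.Adj x y → (x ∈ R ∧ y ∈ B) ∨ (x ∈ B ∧ y ∈ R)
  deg : ∀ x, (G.neighborSet x).encard ≤ 2
  stab : ∀ x ∈ R, ∀ y ∈ B, ∀ z w, G.Adj x z → G.Adj y w →
    |x - y| < |x - z| → |x - y| < |y - w| → G.Adj x y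

namespace WeaklyStable

variable {R B : Set ℝ} {G : SimpleGraph ℝ}

lemma swap (h : WeaklyStable R B G) : WeaklyStable B R G where
  disj := h.disj.symm
  bip x y hxy := (h.bip x y hxy).symm
  deg := h.deg
  stab x hx y hy z w hxz hyw h1 h2 := by
    rw [abs_sub_comm] at h1 h2
    exact (h.stab y hy x hx w z hyw hxz h2 h1).symm

lemma reflect (h : WeaklyStable R B G) :
    WeaklyStable (Neg.neg ⁻¹' R) (Neg.neg ⁻¹' B) (G.comap Neg.neg) where
  disj := h.disj.preimage _
  bip x y hxy := h.bip _ _ hxy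
  deg x := by
    have : (G.comap Neg.neg).neighborSet x = Neg.neg ⁻¹' (G.neighborSet (-x)) := by
      ext y; simp
    rw [this, Set.encard_preimage_of_injective_subset_range neg_injective
      (by rw [neg_surjective.range_eq]; exact Set.subset_univ _)]
    exact h.deg _
  stab x hx y hy z w hxz hyw h1 h2 := by
    have e : ∀ a b : ℝ, |-a - -b| = |a - b| := fun a b => by
      rw [← abs_neg (a - b)]; congr 1; ring
    exact h.stab (-x) hx (-y) hy (-z) (-w) hxz hyw (by rwa [e, e]) (by rwa [e, e])

lemma notMem_blue (h : WeaklyStable R B G) {x : ℝ} (hx : x ∈ R) : x ∉ B :=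
  fun hb => h.disj.le_bot ⟨hx, hb⟩

lemma blue_of_adj (h : WeaklyStable R B G) {x y : ℝ} (hxy : G.Adj x y) (hx : x ∈ R) : y ∈ B := by
  rcases h.bip _ _ hxy with h1 | h1
  · exact h1.2
  · exact absurd h1.1 (h.notMem_blue hx)

lemma red_of_adj (h : WeaklyStable R B G) {x y : ℝ} (hxy : G.Adj x y) (hx : x ∈ B) : y ∈ R :=
  h.swap.blue_of_adj hxy hx

lemma eq_or_eq_or_eq (h : WeaklyStable R B G) {x y z w : ℝ} (hy : G.Adj x y) (hz : G.Adj x z)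
    (hw : G.Adj x w) : y = z ∨ y = w ∨ z = w := by
  by_contra! hne
  have hsub : ({y, z, w} : Set ℝ) ⊆ G.neighborSet x := by
    rintro a (rfl | rfl | rfl) <;> assumption
  have h3 : ({y, z, w} : Set ℝ).encard = 3 :=
    Set.encard_eq_three.2 ⟨y, z, w, hne.1, hne.2.1, hne.2.2, rfl⟩
  have := (Set.encard_le_encard hsub).trans (h.deg x)
  rw [h3] at this
  exact absurd this (by decide)

lemma finite_neighborSet (h : WeaklyStable R B G) (x : ℝ) : (G.neighborSet x).Finite :=
  Set.finite_of_encard_le_coe (k := 2) (h.deg x)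

/-- The neighbors of a vertex, as a finset. -/
noncomputable def nbrs (h : WeaklyStable R B G) (x : ℝ) : Finset ℝ :=
  (h.finite_neighborSet x).toFinset

@[simp] lemma mem_nbrs (h : WeaklyStable R B G) {x y : ℝ} : y ∈ h.nbrs x ↔ G.Adj x y := by
  simp [nbrs]

lemma card_nbrs_le (h : WeaklyStable R B G) (x : ℝ) : (h.nbrs x).card ≤ 2 := by
  have := h.deg x
  rw [(h.finite_neighborSet x).encard_eq_coe_toFinset_card] at this
  exact_mod_cast this

lemma card_nbrs_eq (h : WeaklyStable R B G) {x : ℝ} (hx : (G.neighborSet x).encard = 2) :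
    (h.nbrs x).card = 2 := by
  rw [(h.finite_neighborSet x).encard_eq_coe_toFinset_card] at hx
  exact_mod_cast hx

lemma adj_of_cross_same (h : WeaklyStable R B G) {a b c d : ℝ} (hab : a < b) (hbc : b < c)
    (hcd : c < d) (hac : G.Adj a c) (hbd : G.Adj b d) (ha : a ∈ R) (hb : b ∈ R) : G.Adj b c := by
  refine h.stab b hb c (h.blue_of_adj hac ha) d a hbd hac.symm ?_ ?_
  · rw [abs_of_neg (by linarith), abs_of_neg (by linarith)]; linarith
  · rw [abs_of_neg (by linarith), abs_of_pos (by linarith)]; linarith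

lemma adj_of_cross_opp (h : WeaklyStable R B G) {a b c d : ℝ} (hab : a < b) (hbc : b < c)
    (hcd : c < d) (hac : G.Adj a c) (hbd : G.Adj b d) (ha : a ∈ R) (hb : b ∈ B) :
    G.Adj a b ∨ G.Adj c d := by
  by_contra! hn
  have h1 : ¬ |a - b| < |b - d| := fun hlt =>
    hn.1 (h.stab a ha b hb c d hac hbd (by
      rw [abs_of_neg (by linarith), abs_of_neg (by linarith)]; linarith) hlt)
  have h2 : ¬ |d - c| < |c - a| := fun hlt =>
    hn.2 (h.stab d (h.red_of_adj hbd hb) c (h.blue_of_adj hac ha) b a hbd.symm hac.symm (by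
      rw [abs_of_pos (by linarith), abs_of_pos (by linarith)]; linarith) hlt).symm
  rw [abs_of_neg (by linarith), abs_of_neg (by linarith)] at h1
  rw [abs_of_pos (by linarith), abs_of_pos (by linarith)] at h2
  linarith

/-- Two crossing edges of a weakly stable graph are joined by an edge, so that they are at distance
one in their common component. -/
lemma adj_of_cross (h : WeaklyStable R B G) {a b c d : ℝ} (hab : a < b) (hbc : b < c)
    (hcd : c < d) (hac : G.Adj a c) (hbd : G.Adj b d) : G.Adj a b ∨ G.Adj b c ∨ G.Adj c d := by
  rcases h.bip _ _ hac with ⟨ha, -⟩ | ⟨ha, -⟩ <;> rcases h.bip _ _ hbd with ⟨hb, -⟩ | ⟨hb, -⟩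
  · exact .inr (.inl (h.adj_of_cross_same hab hbc hcd hac hbd ha hb))
  · have := h.adj_of_cross_opp hab hbc hcd hac hbd ha hb; tauto
  · have := h.swap.adj_of_cross_opp hab hbc hcd hac hbd ha hb; tauto
  · exact .inr (.inl (h.swap.adj_of_cross_same hab hbc hcd hac hbd ha hb))

/-- An edge with one endpoint strictly under an edge `x y` and the other one strictly outside is
joined to `x y` by an edge. -/
lemma adj_of_exit (h : WeaklyStable R B G) {x y p q : ℝ} (hxy : G.Adj x y) (hpq : G.Adj p q)
    (hxp : x < p) (hpy : p < y) (hq : q < x ∨ y < q) :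
    (G.Adj x p ∨ G.Adj x q) ∨ G.Adj y p ∨ G.Adj y q := by
  rcases hq with hq | hq
  · have := h.adj_of_cross hq hxp hpy hpq.symm hxy
    simp only [G.adj_comm] at *; tauto
  · have := h.adj_of_cross hxp hpy hq hxy hpq
    simp only [G.adj_comm] at *; tauto

/-! ### Counting edges over a point -/

/-- If each point of a stretch is covered by two edges running from red on the left to blue on the
right, then one of those edges covers the whole stretch: the two edges over the right end of an edge
reaching as far as possible would start behind the left end of the stretch, hence both cross that
edge, and stability would create a vertex of degree three. -/
lemma exists_long_edge (h : WeaklyStable R B G) (hR : ∀ a b, (R ∩ Set.Icc a b).Finite)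
    {F : Set (ℝ × ℝ)} {x l u : ℝ} (hlu : l ≤ u)
    (hF : ∀ e ∈ F, e.1 ∈ R ∧ G.Adj e.1 e.2 ∧ x < e.1)
    (h2 : ∀ s, l ≤ s → s ≤ u → ∃ e ∈ F, ∃ e' ∈ F, e ≠ e' ∧ (e.1 ≤ s ∧ s < e.2) ∧
      e'.1 ≤ s ∧ s < e'.2) :
    ∃ e ∈ F, e.1 ≤ l ∧ u < e.2 := by
  have hfin : {e | e ∈ F ∧ e.1 ≤ l ∧ l < e.2}.Finite := by
    refine (((hR x l).biUnion (t := fun p => (fun q => (p, q)) '' G.neighborSet p)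
      fun p _ => (h.finite_neighborSet p).image _)).subset ?_
    rintro ⟨p, q⟩ ⟨he, h1, -⟩
    obtain ⟨hp, hpq, hx⟩ := hF _ he
    exact Set.mem_biUnion (x := p) ⟨hp, hx.le, h1⟩ ⟨q, hpq, rfl⟩
  obtain ⟨e0, he0, -, -, -, h0, -⟩ := h2 l le_rfl hlu
  obtain ⟨⟨p, q⟩, ⟨he, hpl, hlq⟩, hmax⟩ :=
    Set.exists_max_image _ (fun e : ℝ × ℝ => e.2) hfin ⟨e0, he0, h0⟩
  refine ⟨_, he, hpl, ?_⟩
  by_contra! hqu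
  simp only at hpl hlq hqu hmax
  obtain ⟨hp, hpq, -⟩ := hF _ he
  have key : ∀ e ∈ F, e.1 ≤ q → q < e.2 → G.Adj e.1 q ∧ p ≠ e.1 := by
    rintro ⟨a, b⟩ hab haq hqb
    simp only at haq hqb ⊢
    obtain ⟨ha, hadj, -⟩ := hF _ hab
    simp only at ha hadj
    have hla : l < a := by
      by_contra! hal
      exact absurd (hmax _ ⟨hab, hal, hlq.trans hqb⟩) (not_le.2 hqb)
    have hne : a ≠ q := by
      rintro rfl
      exact h.notMem_blue ha (h.blue_of_adj hpq hp)
    exact ⟨h.adj_of_cross_same (hpl.trans_lt hla) (lt_of_le_of_ne haq hne) hqb hpq hadj hp ha,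
      (hpl.trans_lt hla).ne⟩
  obtain ⟨⟨a, b⟩, hab, ⟨a', b'⟩, hab', hne, ⟨h1, h3⟩, h4, h5⟩ := h2 q hlq.le hqu
  obtain ⟨k1, k2⟩ := key _ hab h1 h3
  obtain ⟨k3, k4⟩ := key _ hab' h4 h5
  simp only at *
  have haa : a = a' := by
    rcases h.eq_or_eq_or_eq hpq.symm k1.symm k3.symm with e | e | e
    · exact absurd e k2
    · exact absurd e k4
    · exact e
  subst haa
  rcases h.eq_or_eq_or_eq k1 (hF _ hab).2.1 (hF _ hab').2.1 with e | e | e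
  · exact absurd e h3.ne
  · exact absurd e h5.ne
  · exact hne (by simpa using e)

/-- Double counting of the edges at `A`: if the vertices of `A` outside an exceptional set `E` have
degree two, then the edges that lead from `A \ E` to somewhere else than `A'` are at least
`2 |A| - 2 |A'| - 2 |E|` in number. -/
lemma exists_leaving_edges (h : WeaklyStable R B G) (A A' E : Finset ℝ)
    (hA : ∀ p ∈ A, p ∉ E → (G.neighborSet p).encard = 2) :
    ∃ O : Finset (ℝ × ℝ), (∀ e ∈ O, e.1 ∈ A ∧ e.1 ∉ E ∧ G.Adj e.1 e.2 ∧ e.2 ∉ A') ∧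
      2 * A.card ≤ 2 * A'.card + 2 * E.card + O.card := by
  classical
  let T := (A \ E).sigma fun p => h.nbrs p
  have hT : T.card = 2 * (A \ E).card := by
    rw [Finset.card_sigma, Finset.sum_congr rfl (g := fun _ => 2), Finset.sum_const, smul_eq_mul,
      mul_comm]
    intro p hp
    rw [Finset.mem_sdiff] at hp
    exact h.card_nbrs_eq (hA p hp.1 hp.2)
  have hin : (T.filter fun e => e.2 ∈ A').card ≤ 2 * A'.card := by
    have h1 : (A'.sigma fun q => h.nbrs q).card ≤ 2 * A'.card := by
      rw [Finset.card_sigma, mul_comm]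
      exact Finset.sum_le_card_nsmul _ _ _ fun q _ => h.card_nbrs_le q
    refine le_trans (Finset.card_le_card_of_injOn (fun e => ⟨e.2, e.1⟩) ?_ ?_) h1
    · intro e he
      simp only [T, Finset.coe_filter, Finset.mem_sigma, mem_nbrs, Set.mem_ofPred_eq] at he
      simp only [Finset.coe_sigma, Set.mem_sigma_iff, Finset.mem_coe, mem_nbrs]
      exact ⟨he.2, he.1.2.symm⟩
    · rintro ⟨a, b⟩ - ⟨c, d⟩ - he
      simp only [Sigma.mk.injEq, heq_eq_eq] at he ⊢
      exact ⟨he.2, he.1⟩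
  refine ⟨(T.filter fun e => e.2 ∉ A').image fun e => (e.1, e.2), ?_, ?_⟩
  · intro e he
    simp only [T, Finset.mem_image, Finset.mem_filter, Finset.mem_sigma, Finset.mem_sdiff,
      mem_nbrs] at he
    obtain ⟨f, ⟨⟨⟨h1, h2⟩, h3⟩, h4⟩, rfl⟩ := he
    exact ⟨h1, h2, h3, h4⟩
  · rw [Finset.card_image_of_injective]
    · have h1 := Finset.card_filter_add_card_filter_not (s := T) (fun e => e.2 ∈ A')
      have h2 := Finset.card_le_card_sdiff_add_card (s := A) (t := E)
      omega
    · rintro ⟨a, b⟩ ⟨c, d⟩ he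
      simpa using he

/-- A finite set of edges has at most `2 |Q|` members ending in `Q`. -/
lemma card_filter_snd_mem_le (h : WeaklyStable R B G) (O : Finset (ℝ × ℝ))
    (hO : ∀ e ∈ O, G.Adj e.1 e.2) (Q : Finset ℝ) :
    (O.filter fun e => e.2 ∈ Q).card ≤ 2 * Q.card := by
  have h1 : (Q.sigma fun q => h.nbrs q).card ≤ 2 * Q.card := by
    rw [Finset.card_sigma, mul_comm]
    exact Finset.sum_le_card_nsmul _ _ _ fun q _ => h.card_nbrs_le q
  refine le_trans (Finset.card_le_card_of_injOn (fun e => ⟨e.2, e.1⟩) ?_ ?_) h1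
  · intro e he
    simp only [Finset.coe_filter, Set.mem_ofPred_eq] at he
    simp only [Finset.coe_sigma, Set.mem_sigma_iff, Finset.mem_coe, mem_nbrs]
    exact ⟨he.2, (hO e he.1).symm⟩
  · rintro ⟨a, b⟩ - ⟨c, d⟩ - he
    simp only [Sigma.mk.injEq, heq_eq_eq] at he
    exact Prod.ext he.2 he.1

end WeaklyStable

/-! ### Infinite components are bi-infinite paths -/

lemma exists_other_neighbor {V : Type*} {G : SimpleGraph V} {a b : V} (hab : G.Adj a b)
    (h2 : (G.neighborSet b).encard = 2) :
    ∃ c, G.Adj b c ∧ c ≠ a ∧ ∀ d, G.Adj b d → d = a ∨ d = c := by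
  obtain ⟨x, y, hxy, hs⟩ := Set.encard_eq_two.1 h2
  have hmem : ∀ d, G.Adj b d ↔ d = x ∨ d = y := fun d => by
    rw [← SimpleGraph.mem_neighborSet, hs]; simp
  rcases (hmem a).1 hab.symm with rfl | rfl
  · exact ⟨y, (hmem y).2 (.inr rfl), hxy.symm, fun d hd => (hmem d).1 hd⟩
  · exact ⟨x, (hmem x).2 (.inl rfl), hxy, fun d hd => ((hmem d).1 hd).symm⟩

/-- An infinite component of a graph with all degrees zero or two is a bi-infinite path: follow the
non-backtracking walk along an edge in both directions. -/
lemma exists_biinfinite_path {V : Type*} {G : SimpleGraph V}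
    (h2 : ∀ x y, G.Adj x y → (G.neighborSet x).encard = 2) {a b : V} (hab : G.Adj a b)
    (hinf : {u | G.Reachable a u}.Infinite) :
    ∃ v : ℤ → V, Function.Injective v ∧ (∀ k, G.Adj (v k) (v (k + 1))) ∧
      (∀ k c, G.Adj (v k) c → c = v (k - 1) ∨ c = v (k + 1)) ∧ v 0 = a ∧ v 1 = b ∧
      ∀ u, G.Reachable a u → ∃ k, v k = u := by
  classical
  let D := {p : V × V // G.Adj p.1 p.2}
  have hex : ∀ d : D, ∃ c, G.Adj d.1.2 c ∧ c ≠ d.1.1 ∧ ∀ e, G.Adj d.1.2 e → e = d.1.1 ∨ e = c :=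
    fun d => exists_other_neighbor d.2 (h2 _ _ d.2.symm)
  choose o ho1 ho2 ho3 using hex
  let σ : Equiv.Perm D :=
    { toFun := fun d => ⟨(d.1.2, o d), ho1 d⟩
      invFun := fun d => ⟨(o ⟨(d.1.2, d.1.1), d.2.symm⟩, d.1.1), (ho1 _).symm⟩
      left_inv := by
        rintro ⟨⟨x, y⟩, hxy⟩
        have hxy' : G.Adj x y := hxy
        have := ho3 ⟨(o ⟨(x, y), hxy⟩, y), (ho1 _).symm⟩ x hxy'.symm
        have h3 := ho2 ⟨(x, y), hxy⟩
        simp only at this h3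
        refine Subtype.ext (Prod.ext ?_ rfl)
        rcases this with h | h
        · exact absurd h.symm h3
        · exact h.symm
      right_inv := by
        rintro ⟨⟨x, y⟩, hxy⟩
        have hxy' : G.Adj x y := hxy
        have := ho3 ⟨(o ⟨(y, x), hxy'.symm⟩, x), (ho1 _).symm⟩ y hxy'
        have h3 := ho2 ⟨(y, x), hxy'.symm⟩
        simp only at this h3
        refine Subtype.ext (Prod.ext rfl ?_)
        rcases this with h | h
        · exact absurd h.symm h3
        · exact h.symm }
  let d0 : D := ⟨(a, b), hab⟩
  let v : ℤ → V := fun k => ((σ ^ k) d0).1.1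
  have hsucc : ∀ k : ℤ, (σ ^ (k + 1)) d0 = σ ((σ ^ k) d0) := fun k => by
    rw [add_comm, zpow_add, zpow_one, Equiv.Perm.mul_apply]
  have hv1 : ∀ k, v (k + 1) = ((σ ^ k) d0).1.2 := fun k => by simp only [v, hsucc]; rfl
  have hadj : ∀ k, G.Adj (v k) (v (k + 1)) := fun k => by rw [hv1]; exact ((σ ^ k) d0).2
  have hv2 : ∀ k, v (k + 1 + 1) = o ((σ ^ k) d0) := fun k => by rw [hv1, hsucc]; rfl
  have hne : ∀ k, v (k + 1 + 1) ≠ v k := fun k => by rw [hv2]; exact ho2 _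
  have hnb : ∀ k c, G.Adj (v k) c → c = v (k - 1) ∨ c = v (k + 1) := by
    intro k c hc
    obtain ⟨k, rfl⟩ : ∃ j, k = j + 1 := ⟨k - 1, by ring⟩
    have hc' : G.Adj ((σ ^ k) d0).1.2 c := by rwa [← hv1]
    have := ho3 _ c hc'
    rw [add_sub_cancel_right, hv2]
    exact this
  have hrange : ∀ u, G.Reachable a u → ∃ k, v k = u := by
    intro u hu
    rw [SimpleGraph.reachable_iff_reflTransGen] at hu
    induction hu with
    | refl => exact ⟨0, rfl⟩
    | tail _ hbc ih =>
      obtain ⟨k, rfl⟩ := ih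
      rcases hnb _ _ hbc with h | h
      · exact ⟨_, h.symm⟩
      · exact ⟨_, h.symm⟩
  have hinj : ∀ n : ℕ, ∀ i : ℤ, v i ≠ v (i + (n + 1 : ℕ)) := by
    intro n
    induction n using Nat.strong_induction_on with
    | _ n ih =>
      intro i hi
      match n with
      | 0 => exact (hadj i).ne (by simpa using hi)
      | 1 =>
        refine hne i ?_
        rw [hi]; congr 1; push_cast; ring
      | m + 2 =>
        have e1 : G.Adj (v i) (v (i + (m + 2 : ℕ))) := by
          rw [hi]
          have := (hadj (i + (m + 2 : ℕ))).symm
          convert! this using 2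
          push_cast; ring
        rcases hnb _ _ e1 with h | h
        · -- the walk is periodic, so that the component is finite
          have hd : (σ ^ (i - 1)) d0 = (σ ^ (i - 1 + (m + 3 : ℕ))) d0 := by
            refine Subtype.ext (Prod.ext ?_ ?_)
            · change v (i - 1) = v (i - 1 + (m + 3 : ℕ))
              rw [← h]; congr 1; push_cast; ring
            · rw [← hv1, ← hv1]
              convert! hi using 2
              · ring
              · push_cast; ring
          have hper : ∀ k, v (k + (m + 3 : ℕ)) = v k := by
            intro k
            have : (σ ^ (k + (m + 3 : ℕ))) d0 = (σ ^ k) d0 := by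
              have e2 : k + ((m + 3 : ℕ) : ℤ) = (k - (i - 1)) + (i - 1 + (m + 3 : ℕ)) := by ring
              rw [e2, zpow_add, Equiv.Perm.mul_apply, ← hd, ← Equiv.Perm.mul_apply, ← zpow_add]
              congr 2; ring
            simp only [v, this]
          refine hinf (((Set.finite_Ico (0 : ℤ) (m + 3 : ℕ)).image v).subset ?_)
          intro u hu
          obtain ⟨k, rfl⟩ := hrange u hu
          have hper' : Function.Periodic v ((m + 3 : ℕ) : ℤ) := hper
          refine ⟨k % (m + 3 : ℕ), ⟨Int.emod_nonneg _ (by positivity),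
            Int.emod_lt_of_pos _ (by positivity)⟩, ?_⟩
          conv_rhs => rw [← Int.emod_add_mul_ediv k (m + 3 : ℕ), mul_comm]
          exact ((hper'.int_mul (k / (m + 3 : ℕ))) _).symm
        · refine ih m (by omega) (i + 1) ?_
          rw [← h]; congr 1; push_cast; ring
  refine ⟨v, ?_, hadj, hnb, rfl, hv1 0, hrange⟩
  intro i j hij
  by_contra hne'
  rcases lt_or_gt_of_ne hne' with hlt | hlt
  · refine hinj (j - i - 1).toNat i ?_
    rw [hij]; congr 1; omega
  · refine hinj (i - j - 1).toNat j ?_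
    rw [← hij]; congr 1; omega

namespace WeaklyStable

variable {R B : Set ℝ} {G : SimpleGraph ℝ}

/-- A point of an infinite component that lies under an edge `x y` is a neighbor of `x` or of `y`:
otherwise one of the two halves of the path would be trapped under `x y`, since edges crossing `x y`
are close to it on the path. -/
lemma adj_of_straddle (h : WeaklyStable R B G) (hR : ∀ a b, (R ∩ Set.Icc a b).Finite)
    (hB : ∀ a b, (B ∩ Set.Icc a b).Finite)
    (h2 : ∀ x y, G.Adj x y → (G.neighborSet x).encard = 2) {u x y : ℝ}
    (hinf : {w | G.Reachable u w}.Infinite) (hxy : G.Adj x y) (hxu : x < u) (huy : u < y) :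
    G.Adj u x ∨ G.Adj u y := by
  by_contra! hn
  have hfin : {w | (w ∈ R ∨ w ∈ B) ∧ x < w ∧ w < y}.Finite := by
    refine ((hR x y).union (hB x y)).subset ?_
    rintro w ⟨hw | hw, h1, h2⟩
    · exact .inl ⟨hw, h1.le, h2.le⟩
    · exact .inr ⟨hw, h1.le, h2.le⟩
  have hpt : ∀ {a b}, G.Adj a b → a ∈ R ∨ a ∈ B := fun hab => by
    rcases h.bip _ _ hab with h | h
    · exact .inl h.1
    · exact .inr h.1
  have hstep : ∀ p q, G.Adj p q → x < p → p < y → (x < q ∧ q < y) ∨ q = x ∨ q = y ∨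
      ((G.Adj x p ∨ G.Adj x q) ∨ G.Adj y p ∨ G.Adj y q) := by
    intro p q hpq hp1 hp2
    rcases lt_trichotomy q x with hq | hq | hq
    · exact .inr (.inr (.inr (h.adj_of_exit hxy hpq hp1 hp2 (.inl hq))))
    · tauto
    · rcases lt_trichotomy q y with hq' | hq' | hq'
      · tauto
      · tauto
      · exact .inr (.inr (.inr (h.adj_of_exit hxy hpq hp1 hp2 (.inr hq'))))
  by_cases hr : G.Reachable x u
  · have hinf' : {w | G.Reachable x w}.Infinite := by
      convert! hinf using 2
      ext w
      exact ⟨fun hw => hr.symm.trans hw, fun hw => hr.trans hw⟩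
    obtain ⟨v, hinj, hadj, hnb, h0, h1, hrange⟩ := exists_biinfinite_path h2 hxy hinf'
    have hadj' : ∀ i j, G.Adj (v i) (v j) → j = i - 1 ∨ j = i + 1 := fun i j hij =>
      (hnb i _ hij).imp (fun e => hinj e) (fun e => hinj e)
    obtain ⟨k, rfl⟩ := hrange u hr
    subst h0 h1
    have hk : k ≠ 0 ∧ k ≠ 1 ∧ k ≠ 2 ∧ k ≠ -1 := by
      refine ⟨?_, ?_, ?_, ?_⟩ <;> rintro rfl
      · exact hxu.ne rfl
      · exact huy.ne rfl
      · exact hn.2 (hadj 1).symm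
      · exact hn.1 (hadj (-1))
    -- the half of the path beyond `v k` that does not contain the edge `v 0 v 1` stays under it
    have trap : ∀ s : ℤ, (s = 1 ∧ 3 ≤ k) ∨ (s = -1 ∧ k ≤ -2) → ∀ m : ℕ,
        v 0 < v (k + s * m) ∧ v (k + s * m) < v 1 := by
      intro s hs' m
      induction m with
      | zero => simpa using ⟨hxu, huy⟩
      | succ m ih =>
        have e : G.Adj (v (k + s * m)) (v (k + s * (m + 1 : ℕ))) := by
          rcases hs' with ⟨rfl, -⟩ | ⟨rfl, -⟩
          · convert! hadj (k + 1 * m) using 2; push_cast; ring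
          · convert! (hadj (k + -1 * (m + 1 : ℕ))).symm using 2; push_cast; ring
        rcases hstep _ _ e ih.1 ih.2 with h3 | h3 | h3 | (h3 | h3) | (h3 | h3)
        · exact h3
        all_goals
          first
            | replace h3 := hinj h3
            | replace h3 := hadj' _ _ h3
          push_cast at h3
          rcases hs' with ⟨rfl, hk'⟩ | ⟨rfl, hk'⟩ <;> omega
    rcases lt_or_gt_of_ne hk.1 with hneg | hpos
    · have := trap (-1) (.inr ⟨rfl, by omega⟩)
      refine Set.infinite_of_injective_forall_mem (f := fun m : ℕ => v (k + -1 * m)) ?_ ?_ hfin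
      · intro m n hmn
        have := hinj hmn
        omega
      · exact fun m => ⟨hpt (hadj _), this m⟩
    · have := trap 1 (.inl ⟨rfl, by omega⟩)
      refine Set.infinite_of_injective_forall_mem (f := fun m : ℕ => v (k + 1 * m)) ?_ ?_ hfin
      · intro m n hmn
        have := hinj hmn
        omega
      · exact fun m => ⟨hpt (hadj _), this m⟩
  · -- no edge of the component of `u` meets or crosses the edge `x y`
    refine hinf ((hfin.insert u).subset ?_)
    have key : ∀ w, G.Reachable u w → x < w ∧ w < y := by
      intro w hw
      have hw' := hw
      rw [SimpleGraph.reachable_iff_reflTransGen] at hw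
      induction hw with
      | refl => exact ⟨hxu, huy⟩
      | @tail p q hp hpq ih =>
        have hrp : G.Reachable u p := by rwa [SimpleGraph.reachable_iff_reflTransGen]
        have hno : ∀ z, G.Adj x z ∨ z = x ∨ z = y ∨ G.Adj y z → ¬ G.Reachable u z := by
          rintro z hz hrz
          refine hr (SimpleGraph.Reachable.trans ?_ hrz.symm)
          rcases hz with hz | rfl | rfl | hz
          · exact hz.reachable
          · exact .rfl
          · exact hxy.reachable
          · exact hxy.reachable.trans hz.reachable
        have := hstep p q hpq (ih hrp).1 (ih hrp).2
        have h3 := fun hz => hno p hz hrp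
        have h4 := fun hz => hno q hz hw'
        tauto
    intro w hw
    by_cases hwu : w = u
    · exact .inl hwu
    · obtain ⟨z, hz⟩ : ∃ z, G.Adj w z := by
        obtain ⟨p⟩ := (hw : G.Reachable u w).symm
        cases p with
        | nil => exact absurd rfl hwu
        | cons h _ => exact ⟨_, h⟩
      exact .inr ⟨hpt hz, key w hw⟩

end WeaklyStable

/-! ### The walk of red minus blue points -/

/-- The number of red points minus the number of blue points in `(s, t]`. -/
noncomputable def excess (R B : Set ℝ) (s t : ℝ) : ℤ :=
  (R ∩ Set.Ioc s t).ncard - (B ∩ Set.Ioc s t).ncard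

/-- The walk that goes up at the red and down at the blue points, started from zero at the origin;
of the two terms, one vanishes. -/
noncomputable def walk (R B : Set ℝ) (t : ℝ) : ℤ := excess R B 0 t - excess R B t 0

lemma excess_swap (R B : Set ℝ) (s t : ℝ) : excess B R s t = -excess R B s t := by
  simp [excess]

lemma finite_inter_Ioc {R : Set ℝ} (hR : ∀ a b, (R ∩ Set.Icc a b).Finite) (a b : ℝ) :
    (R ∩ Set.Ioc a b).Finite :=
  (hR a b).subset (Set.inter_subset_inter_right _ Set.Ioc_subset_Icc_self)

lemma ncard_inter_Ioc_add {R : Set ℝ} (hR : ∀ a b, (R ∩ Set.Icc a b).Finite) {s t u : ℝ}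
    (hst : s ≤ t) (htu : t ≤ u) :
    (R ∩ Set.Ioc s t).ncard + (R ∩ Set.Ioc t u).ncard = (R ∩ Set.Ioc s u).ncard := by
  rw [← Set.Ioc_union_Ioc_eq_Ioc hst htu, Set.inter_union_distrib_left, Set.ncard_union_eq _
    (finite_inter_Ioc hR s t) (finite_inter_Ioc hR t u)]
  exact (Set.Ioc_disjoint_Ioc_of_le le_rfl).mono Set.inter_subset_right Set.inter_subset_right

lemma walk_sub {R B : Set ℝ} (hR : ∀ a b, (R ∩ Set.Icc a b).Finite)
    (hB : ∀ a b, (B ∩ Set.Icc a b).Finite) {s t : ℝ} (hst : s ≤ t) :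
    walk R B t - walk R B s = excess R B s t := by
  have hadd : ∀ {a b c : ℝ}, a ≤ b → b ≤ c →
      excess R B a b + excess R B b c = excess R B a c := fun h1 h2 => by
    simp only [excess, ← ncard_inter_Ioc_add hR h1 h2, ← ncard_inter_Ioc_add hB h1 h2]
    push_cast; ring
  have h0 : ∀ {a b : ℝ}, b ≤ a → excess R B a b = 0 := fun h => by
    simp [excess, Set.Ioc_eq_empty (not_lt.2 h)]
  rcases le_total 0 s with h1 | h1
  · have := hadd h1 hst
    simp only [walk, h0 h1, h0 (h1.trans hst)]; omega
  · rcases le_total 0 t with h2 | h2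
    · have := hadd h1 h2
      simp only [walk, h0 h1, h0 h2]; omega
    · have := hadd hst h2
      simp only [walk, h0 h1, h0 h2]; omega

/-! ### Components of stable graphs with all degrees two -/

/-- A weakly stable graph in which all red and blue points have degree two, on locally finite point
sets. -/
structure FullyStable (R B : Set ℝ) (G : SimpleGraph ℝ) : Prop extends WeaklyStable R B G where
  finR : ∀ a b, (R ∩ Set.Icc a b).Finite
  finB : ∀ a b, (B ∩ Set.Icc a b).Finite
  degR : ∀ x ∈ R, (G.neighborSet x).encard = 2
  degB : ∀ x ∈ B, (G.neighborSet x).encard = 2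

namespace FullyStable

variable {R B : Set ℝ} {G : SimpleGraph ℝ}

lemma swap (h : FullyStable R B G) : FullyStable B R G :=
  ⟨h.toWeaklyStable.swap, h.finB, h.finR, h.degB, h.degR⟩

lemma reflect (h : FullyStable R B G) :
    FullyStable (Neg.neg ⁻¹' R) (Neg.neg ⁻¹' B) (G.comap Neg.neg) := by
  have hf : ∀ {S : Set ℝ}, (∀ a b, (S ∩ Set.Icc a b).Finite) → ∀ a b,
      (Neg.neg ⁻¹' S ∩ Set.Icc a b).Finite := fun {S} hS a b => by
    refine ((hS (-b) (-a)).preimage neg_injective.injOn).subset ?_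
    rintro x ⟨hx, h1, h2⟩
    exact ⟨hx, neg_le_neg h2, neg_le_neg h1⟩
  have hd : ∀ x, ((G.comap Neg.neg).neighborSet x).encard = (G.neighborSet (-x)).encard := by
    intro x
    have : (G.comap Neg.neg).neighborSet x = Neg.neg ⁻¹' (G.neighborSet (-x)) := by
      ext y; simp
    rw [this, Set.encard_preimage_of_injective_subset_range neg_injective
      (by rw [neg_surjective.range_eq]; exact Set.subset_univ _)]
  exact ⟨h.toWeaklyStable.reflect, hf h.finR, hf h.finB, fun x hx => by rw [hd]; exact h.degR _ hx,
    fun x hx => by rw [hd]; exact h.degB _ hx⟩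

lemma degree_of_adj (h : FullyStable R B G) (x y : ℝ) (hxy : G.Adj x y) :
    (G.neighborSet x).encard = 2 := by
  rcases h.bip _ _ hxy with h1 | h1
  · exact h.degR _ h1.1
  · exact h.degB _ h1.1

/-- Between two points of infinite components, the numbers of red and of blue points differ by a
bounded amount, since few edges lead out of the interval. -/
lemma ncard_inter_Ioo_le (h : FullyStable R B G) {u v : ℝ}
    (hu : {w | G.Reachable u w}.Infinite) (hv : {w | G.Reachable v w}.Infinite) :
    (R ∩ Set.Ioo u v).ncard ≤ (B ∩ Set.Ioo u v).ncard + 8 := by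
  classical
  have hRf : (R ∩ Set.Ioo u v).Finite :=
    (h.finR u v).subset (Set.inter_subset_inter_right _ Set.Ioo_subset_Icc_self)
  have hBf : (B ∩ Set.Ioo u v).Finite :=
    (h.finB u v).subset (Set.inter_subset_inter_right _ Set.Ioo_subset_Icc_self)
  obtain ⟨O, hO, hcard⟩ := h.exists_leaving_edges hRf.toFinset hBf.toFinset
    (h.nbrs u ∪ h.nbrs v) fun p hp _ => h.degR p ((hRf.mem_toFinset.1 hp).1)
  have hQ : O.filter (fun e => e.2 ∈ h.nbrs u ∪ h.nbrs v) = O := by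
    refine Finset.filter_true_of_mem fun e he => ?_
    obtain ⟨h1, h2, h3, h4⟩ := hO e he
    rw [hRf.mem_toFinset] at h1
    rw [hBf.mem_toFinset] at h4
    obtain ⟨h1, hue, hev⟩ := h1
    simp only [Finset.mem_union, WeaklyStable.mem_nbrs, not_or] at h2 ⊢
    have hb := h.blue_of_adj h3 h1
    have hout : e.2 ≤ u ∨ v ≤ e.2 := by
      by_contra! hc
      exact h4 ⟨hb, hc.1, hc.2⟩
    rcases hout with ho | ho
    · rcases ho.eq_or_lt with rfl | ho
      · exact absurd h3.symm h2.1
      · have := h.adj_of_straddle h.finR h.finB h.degree_of_adj hu h3.symm ho hue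
        tauto
    · rcases ho.eq_or_lt with rfl | ho
      · exact absurd h3.symm h2.2
      · have := h.adj_of_straddle h.finR h.finB h.degree_of_adj hv h3 hev ho
        tauto
  have hO2 := h.card_filter_snd_mem_le O (fun e he => (hO e he).2.2.1) (h.nbrs u ∪ h.nbrs v)
  rw [hQ] at hO2
  have h1 := Finset.card_union_le (h.nbrs u) (h.nbrs v)
  have h2 := h.card_nbrs_le u
  have h3 := h.card_nbrs_le v
  rw [Set.ncard_eq_toFinset_card _ hRf, Set.ncard_eq_toFinset_card _ hBf]
  omega

lemma excess_le (h : FullyStable R B G) {u v : ℝ}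
    (hu : {w | G.Reachable u w}.Infinite) (hv : {w | G.Reachable v w}.Infinite) :
    excess R B u v ≤ 9 := by
  have h1 := h.ncard_inter_Ioo_le hu hv
  have h2 : (R ∩ Set.Ioc u v).ncard ≤ (R ∩ Set.Ioo u v).ncard + 1 := by
    refine (Set.ncard_le_ncard (t := insert v (R ∩ Set.Ioo u v)) ?_ ?_).trans
      (Set.ncard_insert_le _ _)
    · rintro x ⟨hx, h1, h2⟩
      rcases h2.eq_or_lt with rfl | h2
      · exact .inl rfl
      · exact .inr ⟨hx, h1, h2⟩
    · exact ((h.finR u v).subset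
        (Set.inter_subset_inter_right _ Set.Ioo_subset_Icc_self)).insert _
  have h3 : (B ∩ Set.Ioo u v).ncard ≤ (B ∩ Set.Ioc u v).ncard :=
    Set.ncard_le_ncard (Set.inter_subset_inter_right _ Set.Ioo_subset_Ioc_self)
      (finite_inter_Ioc h.finB u v)
  simp only [excess]
  omega

/-- The walk is almost constant along the infinite components. -/
lemma walk_sub_le (h : FullyStable R B G) {u v : ℝ}
    (hu : {w | G.Reachable u w}.Infinite) (hv : {w | G.Reachable v w}.Infinite) :
    walk R B v - walk R B u ≤ 9 := by
  rcases le_total u v with huv | huv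
  · rw [walk_sub h.finR h.finB huv]
    exact h.excess_le hu hv
  · have h1 := walk_sub h.finR h.finB huv
    have h2 := h.swap.excess_le hv hu
    rw [excess_swap] at h2
    omega

/-- In an infinite component, an edge from a blue point `x` to a distant red point `y` cannot run
over a long stretch in which the red points outnumber the blue ones: their edges would have to cover
the stretch, and the red endpoint of a long such edge would form an unstable pair with `x`. -/
lemma not_blue_exit_right (h : FullyStable R B G) {x y L : ℝ}
    (hinfx : {w | G.Reachable x w}.Infinite) (hinfy : {w | G.Reachable y w}.Infinite)
    (hL : 0 < L) (hx : x ∈ B) (hxy : G.Adj x y) (hxL : |x| ≤ L) (hy : 4 * L < y)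
    (hex : ∀ s, L ≤ s → s ≤ 4 * L → 5 ≤ excess R B x s) : False := by
  classical
  rw [abs_le] at hxL
  let F : Set (ℝ × ℝ) := {e | e.1 ∈ R ∧ G.Adj e.1 e.2 ∧ x < e.1 ∧ e.2 < y ∧ ¬ G.Adj x e.1}
  obtain ⟨⟨p, q⟩, ⟨hp, hpq, hxp, hqy, hnp⟩, hpL, hLq⟩ :=
    h.exists_long_edge h.finR (F := F) (x := x) (l := L) (u := 4 * L) (by linarith)
      (fun e he => ⟨he.1, he.2.1, he.2.2.1⟩) (by
    intro s hs1 hs2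
    have hRf := finite_inter_Ioc h.finR x s
    have hBf := finite_inter_Ioc h.finB x s
    obtain ⟨O, hO, hcard⟩ := h.exists_leaving_edges hRf.toFinset hBf.toFinset (h.nbrs x)
      fun p hp _ => h.degR p ((hRf.mem_toFinset.1 hp).1)
    have hO2 := h.card_filter_snd_mem_le O (fun e he => (hO e he).2.2.1) (h.nbrs y)
    have hO3 := Finset.card_filter_add_card_filter_not (s := O) (fun e => e.2 ∈ h.nbrs y)
    have h1 := h.card_nbrs_le x
    have h2 := h.card_nbrs_le y
    have h3 := hex s hs1 hs2
    simp only [excess, Set.ncard_eq_toFinset_card _ hRf, Set.ncard_eq_toFinset_card _ hBf] at h3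
    obtain ⟨e, he, e', he', hne⟩ := Finset.one_lt_card.1
      (show 1 < (O.filter fun e => e.2 ∉ h.nbrs y).card by omega)
    have key : ∀ e ∈ O.filter (fun e => e.2 ∉ h.nbrs y), e ∈ F ∧ e.1 ≤ s ∧ s < e.2 := by
      rintro ⟨p, q⟩ he
      rw [Finset.mem_filter] at he
      obtain ⟨h1, h2, h3, h4⟩ := hO _ he.1
      have h5 := he.2
      rw [hRf.mem_toFinset] at h1
      rw [hBf.mem_toFinset] at h4
      simp only [WeaklyStable.mem_nbrs] at h1 h2 h3 h4 h5
      obtain ⟨hp, hxp, hps⟩ := h1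
      have hq := h.blue_of_adj h3 hp
      have hqx : x ≤ q := by
        by_contra! hqx
        rcases h.adj_of_straddle h.finR h.finB h.degree_of_adj hinfx h3.symm hqx hxp with h6 | h6
        · exact h.notMem_blue (h.red_of_adj h6 hx) hq
        · exact h2 h6
      have hqx' : x < q := lt_of_le_of_ne hqx (by rintro rfl; exact h2 h3.symm)
      have hsq : s < q := by
        by_contra! hc
        exact h4 ⟨hq, hqx', hc⟩
      have hqy : q < y := by
        by_contra! hc
        rcases hc.eq_or_lt with rfl | hc
        · exact h.notMem_blue (h.red_of_adj hxy hx) hq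
        · rcases h.adj_of_straddle h.finR h.finB h.degree_of_adj hinfy h3
            (by linarith) hc with h6 | h6
          · exact h.notMem_blue hp (h.blue_of_adj h6 (h.red_of_adj hxy hx))
          · exact h5 h6
      exact ⟨⟨hp, h3, hxp, hqy, h2⟩, hps, hsq⟩
    exact ⟨e, (key e he).1, e', (key e' he').1, hne, (key e he).2, (key e' he').2⟩)
  simp only at *
  refine hnp (h.stab p hp x hx q y hpq hxy ?_ ?_).symm
  · rw [abs_of_pos (by linarith), abs_of_neg (by linarith)]; linarith
  · rw [abs_of_pos (by linarith), abs_of_neg (by linarith)]; linarith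

/-- The mirror image of `not_blue_exit_right` with exchanged colors; its bound on the excess leaves
room for the points at the two ends of the half-open interval. -/
lemma not_red_exit_left (h : FullyStable R B G) {x y L : ℝ}
    (hinfx : {w | G.Reachable x w}.Infinite) (hinfy : {w | G.Reachable y w}.Infinite)
    (hL : 0 < L) (hx : x ∈ R) (hxy : G.Adj x y) (hxL : |x| ≤ L) (hy : y < -(4 * L))
    (hex : ∀ s, L ≤ s → s ≤ 4 * L → excess R B (-s) x ≤ -7) : False := by
  have hreach : ∀ z w, G.Reachable z w → (G.comap Neg.neg).Reachable (-z) (-w) := by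
    intro z w hzw
    let f : G →g G.comap Neg.neg := ⟨fun x => -x, fun {a b} hab => by simpa using hab⟩
    exact hzw.map f
  have hinf : ∀ z, {w | G.Reachable z w}.Infinite →
      {w | (G.comap Neg.neg).Reachable (-z) w}.Infinite := by
    intro z hz
    refine (hz.image (f := Neg.neg) neg_injective.injOn).mono ?_
    rintro _ ⟨w, hw, rfl⟩
    exact hreach z w hw
  refine h.swap.reflect.not_blue_exit_right (x := -x) (y := -y) (L := L) (hinf x hinfx)
    (hinf y hinfy) hL (by simpa using hx) (by simpa using hxy) (by simpa using hxL)
    (by linarith) fun s hs1 hs2 => ?_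
  have h1 := hex s hs1 hs2
  have hpre : ∀ S : Set ℝ, (Neg.neg ⁻¹' S ∩ Set.Ioc (-x) s).ncard = (S ∩ Set.Ico (-s) x).ncard := by
    intro S
    rw [← Set.ncard_image_of_injective (S ∩ Set.Ico (-s) x) (neg_injective (G := ℝ))]
    congr 1
    ext z
    simp only [Set.mem_inter_iff, Set.mem_preimage, Set.mem_Ioc, Set.mem_image, Set.mem_Ico]
    constructor
    · rintro ⟨h1, h2, h3⟩
      exact ⟨-z, ⟨h1, by linarith, by linarith⟩, by simp⟩
    · rintro ⟨w, ⟨h1, h2, h3⟩, rfl⟩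
      exact ⟨by simpa using h1, by linarith, by linarith⟩
  have hle : (B ∩ Set.Ioc (-s) x).ncard ≤ (B ∩ Set.Ico (-s) x).ncard + 1 := by
    refine (Set.ncard_le_ncard (t := insert x (B ∩ Set.Ico (-s) x)) ?_ ?_).trans
      (Set.ncard_insert_le _ _)
    · rintro z ⟨hz, h1, h2⟩
      rcases h2.eq_or_lt with rfl | h2
      · exact .inl rfl
      · exact .inr ⟨hz, h1.le, h2⟩
    · exact ((h.finB (-s) x).subset
        (Set.inter_subset_inter_right _ Set.Ico_subset_Icc_self)).insert _
  have hle' : (R ∩ Set.Ico (-s) x).ncard ≤ (R ∩ Set.Ioc (-s) x).ncard + 1 := by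
    refine (Set.ncard_le_ncard (t := insert (-s) (R ∩ Set.Ioc (-s) x)) ?_ ?_).trans
      (Set.ncard_insert_le _ _)
    · rintro z ⟨hz, h1, h2⟩
      rcases h1.eq_or_lt with rfl | h1
      · exact .inl rfl
      · exact .inr ⟨hz, h1, h2.le⟩
    · exact (finite_inter_Ioc h.finR _ _).insert _
  simp only [excess, hpre] at h1 ⊢
  omega

/-- If the walk makes arbitrarily high excursions of comparable lengths to both sides of the origin,
then all components are finite.  Otherwise take three consecutive vertices of an infinite component
and an excursion far beyond them.  The segment of the path around these vertices before the
excursion leaves it by two long edges, which start at a red point to the right, at a blue point to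
the left.  Two exits to the same side contradict `adj_of_straddle`, and two exits to different sides
give an unstable pair. -/
theorem finite_component (h : FullyStable R B G)
    (hexc : ∀ M : ℤ, ∀ K : ℝ, ∃ L ≥ K, ∀ t, L ≤ |t| → |t| ≤ 4 * L → M ≤ walk R B t) (u : ℝ) :
    {w | G.Reachable u w}.Finite := by
  by_contra hinf
  change Set.Infinite _ at hinf
  obtain ⟨b, hub⟩ : ∃ b, G.Adj u b := by
    obtain ⟨w, hw, hwu⟩ := hinf.exists_notMem_finite (Set.finite_singleton u)
    obtain ⟨p⟩ := (hw : G.Reachable u w)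
    cases p with
    | nil => exact absurd rfl hwu
    | cons h _ => exact ⟨_, h⟩
  obtain ⟨v, hinj, hadj, hnb, -⟩ := exists_biinfinite_path h.degree_of_adj hub hinf
  have hadj' : ∀ i j, G.Adj (v i) (v j) → j = i - 1 ∨ j = i + 1 := fun i j hij =>
    (hnb i _ hij).imp (fun e => hinj e) (fun e => hinj e)
  have hvinf : ∀ k, {w | G.Reachable (v k) w}.Infinite := by
    intro k
    refine Set.infinite_of_injective_forall_mem (f := fun n : ℕ => v (k + n)) ?_ ?_
    · intro m n hmn
      have := hinj hmn
      omega
    · intro n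
      induction n with
      | zero => simp
      | succ n ih =>
        refine SimpleGraph.Reachable.trans ih (SimpleGraph.Adj.reachable ?_)
        convert! hadj (k + n) using 2
        push_cast; ring
  have hpt : ∀ k, v k ∈ R ∨ v k ∈ B := fun k => by
    rcases h.bip _ _ (hadj k) with h | h
    · exact .inl h.1
    · exact .inr h.1
  -- The walk varies by at most `9` along the component, so that `20` leaves an excess of at least
  -- `11` over every vertex of it.
  obtain ⟨L, hLK, hL⟩ := hexc (walk R B (v 0) + 20) (max |v 0| (max |v 1| |v 2|) + 1)
  have hL0 : |v 0| ≤ L := by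
    have := le_max_left |v 0| (max |v 1| |v 2|); linarith
  have hL1 : |v 1| ≤ L := by
    have := (le_max_left |v 1| |v 2|).trans (le_max_right |v 0| _); linarith
  have hL2 : |v 2| ≤ L := by
    have := (le_max_right |v 1| |v 2|).trans (le_max_right |v 0| _); linarith
  have hLpos : 0 < L := by
    have := (abs_nonneg (v 0)).trans (le_max_left |v 0| (max |v 1| |v 2|)); linarith
  have hesc : ∀ f : ℕ → ℤ, Function.Injective f → ∃ n, L < |v (f n)| := by
    intro f hf
    by_contra! hc
    refine Set.infinite_of_injective_forall_mem (f := fun n => v (f n)) (hinj.comp hf)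
      (s := (R ∩ Set.Icc (-L) L) ∪ (B ∩ Set.Icc (-L) L)) ?_ ((h.finR _ _).union (h.finB _ _))
    intro n
    rcases hpt (f n) with h1 | h1
    · exact .inl ⟨h1, abs_le.1 (hc n)⟩
    · exact .inr ⟨h1, abs_le.1 (hc n)⟩
  -- the first exits from `[-L, L]` along the two halves of the path
  obtain ⟨j, hj2, hjL, hjL'⟩ : ∃ j : ℤ, 2 ≤ j ∧ |v j| ≤ L ∧ L < |v (j + 1)| := by
    classical
    have hex := hesc (fun n => (n : ℤ)) Nat.cast_injective
    obtain ⟨m, hm⟩ : ∃ m, Nat.find hex = m := ⟨_, rfl⟩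
    have h1 := Nat.find_spec hex
    rw [hm] at h1
    have h3 : 3 ≤ m := by
      by_contra! hc
      interval_cases m <;> simp only [Nat.cast_zero, Nat.cast_one, Nat.cast_ofNat] at h1 <;>
        linarith
    have h4 := Nat.find_min hex (m := m - 1) (by omega)
    refine ⟨m - 1, by omega, ?_, by simpa using h1⟩
    rw [not_lt, Nat.cast_pred (by omega)] at h4
    exact h4
  obtain ⟨i, hi0, hiL, hiL'⟩ : ∃ i : ℤ, i ≤ 0 ∧ |v i| ≤ L ∧ L < |v (i - 1)| := by
    classical
    have hex := hesc (fun n => -(n : ℤ)) fun a b hab => by simpa using hab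
    obtain ⟨m, hm⟩ : ∃ m, Nat.find hex = m := ⟨_, rfl⟩
    have h1 := Nat.find_spec hex
    rw [hm] at h1
    have h3 : 1 ≤ m := by
      by_contra! hc
      interval_cases m
      simp only [Nat.cast_zero, neg_zero] at h1
      linarith
    have h4 := Nat.find_min hex (m := m - 1) (by omega)
    refine ⟨-(m - 1), by omega, ?_, by convert! h1 using 3; ring⟩
    rw [not_lt, Nat.cast_pred (by omega)] at h4
    exact h4
  have hlevel : ∀ k, walk R B (v k) ≤ walk R B (v 0) + 9 := fun k => by
    have := h.walk_sub_le (hvinf 0) (hvinf k)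
    omega
  -- No vertex lies where the walk is high, so that an exit from `[-L, L]` jumps over that zone.
  have hfar : ∀ k, L < |v k| → 4 * L < |v k| := by
    intro k hk
    by_contra! hc
    have := hL (v k) hk.le hc
    have := hlevel k
    omega
  have hright : ∀ k k', G.Adj (v k) (v k') → |v k| ≤ L → 4 * L < v k' → v k ∈ R := by
    intro k k' hkk hk hk'
    by_contra hc
    refine h.not_blue_exit_right (hvinf k) (hvinf k') hLpos ((hpt k).resolve_left hc) hkk hk hk' ?_
    intro s hs1 hs2
    rw [← walk_sub h.finR h.finB ((le_abs_self _).trans (hk.trans hs1))]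
    have e : |s| = s := abs_of_pos (by linarith)
    have := hL s (by rwa [e]) (by rwa [e])
    have := hlevel k
    omega
  have hleft : ∀ k k', G.Adj (v k) (v k') → |v k| ≤ L → v k' < -(4 * L) → v k ∈ B := by
    intro k k' hkk hk hk'
    by_contra hc
    refine h.not_red_exit_left (hvinf k) (hvinf k') hLpos ((hpt k).resolve_right hc) hkk hk hk' ?_
    intro s hs1 hs2
    rw [← walk_sub h.finR h.finB (by linarith [(abs_le.1 hk).1])]
    have e : |-s| = s := by rw [abs_neg]; exact abs_of_pos (by linarith)
    have := hL (-s) (by rwa [e]) (by rwa [e])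
    have := hlevel k
    omega
  have hadji : G.Adj (v i) (v (i - 1)) := by
    have := (hadj (i - 1)).symm
    rwa [sub_add_cancel] at this
  have hne : v i ≠ v j := fun e => by have := hinj e; omega
  have hi4 := hfar _ hiL'
  have hj4 := hfar _ hjL'
  rw [abs_le] at hiL hjL
  rw [lt_abs] at hi4 hj4
  rcases hj4 with hj4 | hj4
  · have hjR := hright j _ (hadj j) (abs_le.2 hjL) hj4
    rcases hi4 with hi4 | hi4
    · have hiR := hright i _ hadji (abs_le.2 hiL) hi4
      rcases lt_or_gt_of_ne hne with hlt | hlt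
      · rcases h.adj_of_straddle h.finR h.finB h.degree_of_adj (hvinf j) hadji hlt
          (by linarith) with h1 | h1
        · exact h.notMem_blue hiR (h.blue_of_adj h1 hjR)
        · have := hadj' _ _ h1; omega
      · rcases h.adj_of_straddle h.finR h.finB h.degree_of_adj (hvinf i) (hadj j) hlt
          (by linarith) with h1 | h1
        · exact h.notMem_blue hjR (h.blue_of_adj h1 hiR)
        · have := hadj' _ _ h1; omega
    · have hiB := hleft i _ hadji (abs_le.2 hiL) (by linarith)
      have := hadj' _ _ (h.stab _ hjR _ hiB _ _ (hadj j) hadji (by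
        rw [abs_of_neg (by linarith : v j - v (j + 1) < 0), abs_lt]
        constructor <;> linarith) (by
        rw [abs_of_pos (by linarith : 0 < v i - v (i - 1)), abs_lt]
        constructor <;> linarith))
      omega
  · have hjB := hleft j _ (hadj j) (abs_le.2 hjL) (by linarith)
    rcases hi4 with hi4 | hi4
    · have hiR := hright i _ hadji (abs_le.2 hiL) hi4
      have := hadj' _ _ (h.stab _ hiR _ hjB _ _ hadji (hadj j) (by
        rw [abs_of_neg (by linarith : v i - v (i - 1) < 0), abs_lt]
        constructor <;> linarith) (by
        rw [abs_of_pos (by linarith : 0 < v j - v (j + 1)), abs_lt]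
        constructor <;> linarith))
      omega
    · have hiB := hleft i _ hadji (abs_le.2 hiL) (by linarith)
      rcases lt_or_gt_of_ne hne with hlt | hlt
      · rcases h.adj_of_straddle h.finR h.finB h.degree_of_adj (hvinf i) (hadj j).symm
          (by linarith) hlt with h1 | h1
        · have := hadj' _ _ h1; omega
        · exact h.notMem_blue (h.red_of_adj h1 hiB) hjB
      · rcases h.adj_of_straddle h.finR h.finB h.degree_of_adj (hvinf j) hadji.symm
          (by linarith) hlt with h1 | h1
        · have := hadj' _ _ h1; omega
        · exact h.notMem_blue (h.red_of_adj h1 hjB) hiB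

end FullyStable

/-! ### Existence and uniqueness of the stable multi-matching -/

/-- The deterministic properties of the two Poisson point sets on which the theorem rests: they are
locally finite and disjoint, no point has two points of the other color at the same distance, there
are empty intervals of any length arbitrarily far out on both sides, and the walk of red minus blue
points has arbitrarily high and arbitrarily low excursions which take place at the same scale on
both sides of the origin and last from `L` to `4 * L`. -/
structure WellSpread (R B : Set ℝ) : Prop where
  finR : ∀ a b, (R ∩ Set.Icc a b).Finite
  finB : ∀ a b, (B ∩ Set.Icc a b).Finite
  disj : Disjoint R B
  no_tie_red : ∀ x ∈ R, ∀ y ∈ B, ∀ z ∈ B, |x - y| = |x - z| → y = z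
  no_tie_blue : ∀ x ∈ B, ∀ y ∈ R, ∀ z ∈ R, |x - y| = |x - z| → y = z
  gap_right : ∀ a l, ∃ b ≥ a, ∀ p, p ∈ R ∨ p ∈ B → b < p → b + l < p
  gap_left : ∀ a l, ∃ b ≤ a, ∀ p, p ∈ R ∨ p ∈ B → p ≤ b → p ≤ b - l
  exc_red : ∀ M : ℤ, ∀ K : ℝ, ∃ L ≥ K, ∀ t, L ≤ |t| → |t| ≤ 4 * L → M ≤ walk R B t
  exc_blue : ∀ M : ℤ, ∀ K : ℝ, ∃ L ≥ K, ∀ t, L ≤ |t| → |t| ≤ 4 * L → M ≤ walk B R t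

/-- A red-blue pair precedes another one if the two pairs share a point and the first one is
closer. -/
def Precedes (R B : Set ℝ) (e e' : ℝ × ℝ) : Prop :=
  (e.1 ∈ R ∧ e.2 ∈ B) ∧ (e'.1 ∈ R ∧ e'.2 ∈ B) ∧ (e.1 = e'.1 ∨ e.2 = e'.2) ∧
    |e.1 - e.2| < |e'.1 - e'.2|

/-- There are no infinite descending chains of pairs, since such a chain cannot leave the region
between two gaps that are longer than its first pair. -/
lemma WellSpread.wellFounded_precedes {R B : Set ℝ} (h : WellSpread R B) :
    WellFounded (Precedes R B) := by
  rw [WellFounded.wellFounded_iff_has_min]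
  rintro S ⟨m, hm⟩
  by_cases hmRB : m.1 ∈ R ∧ m.2 ∈ B
  swap
  · exact ⟨m, hm, fun e _ he => hmRB he.2.1⟩
  obtain ⟨b, hb, hgap⟩ := h.gap_right (max m.1 m.2) |m.1 - m.2|
  obtain ⟨b', hb', hgap'⟩ := h.gap_left (min m.1 m.2 - 1) |m.1 - m.2|
  let T : Set (ℝ × ℝ) := {e | e ∈ S ∧ (e.1 ∈ R ∧ e.2 ∈ B) ∧ |e.1 - e.2| ≤ |m.1 - m.2| ∧
    (b' ≤ e.1 ∧ e.1 ≤ b) ∧ b' ≤ e.2 ∧ e.2 ≤ b}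
  have hT : T.Finite := by
    refine ((h.finR b' b).prod (h.finB b' b)).subset ?_
    rintro e ⟨-, ⟨h1, h2⟩, -, h3, h4⟩
    exact ⟨⟨h1, h3⟩, h2, h4⟩
  have hmT : m ∈ T := by
    have h1 := le_max_left m.1 m.2
    have h2 := le_max_right m.1 m.2
    have h3 := min_le_left m.1 m.2
    have h4 := min_le_right m.1 m.2
    exact ⟨hm, hmRB, le_rfl, ⟨by linarith, by linarith⟩, by linarith, by linarith⟩
  obtain ⟨e0, he0, hmin⟩ := Set.exists_min_image T (fun e => |e.1 - e.2|) hT ⟨m, hmT⟩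
  refine ⟨e0, he0.1, fun e heS he => ?_⟩
  obtain ⟨heRB, -, hshare, hlt⟩ := he
  obtain ⟨-, -, h3, ⟨h4, h5⟩, h6, h7⟩ := he0
  have hstay : ∀ p q, (p ∈ R ∨ p ∈ B) → |q - p| < |m.1 - m.2| → b' ≤ q → q ≤ b →
      b' ≤ p ∧ p ≤ b := by
    intro p q hp hpq hq1 hq2
    rw [abs_lt] at hpq
    constructor
    · by_contra! hc
      have := hgap' p hp hc.le
      linarith
    · by_contra! hc
      have := hgap p hp hc
      linarith
  have hlt' := hlt.trans_le h3
  refine absurd (hmin e ⟨heS, heRB, hlt'.le, ?_⟩) (not_le.2 hlt)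
  rcases hshare with hs | hs
  · rw [← hs] at h4 h5
    exact ⟨⟨h4, h5⟩, hstay _ _ (.inr heRB.2) hlt' h4 h5⟩
  · rw [← hs] at h6 h7
    exact ⟨hstay _ _ (.inl heRB.1) (by rwa [abs_sub_comm]) h6 h7, h6, h7⟩

/-- A weakly stable graph in which an unlinked red-blue pair has a member that has degree two and
only edges shorter than the pair. -/
structure GreedyStable (R B : Set ℝ) (G : SimpleGraph ℝ) : Prop extends WeaklyStable R B G where
  greedy : ∀ x ∈ R, ∀ y ∈ B, G.Adj x y ∨
    ((G.neighborSet x).encard = 2 ∧ ∀ z, G.Adj x z → |x - z| < |x - y|) ∨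
    ((G.neighborSet y).encard = 2 ∧ ∀ z, G.Adj y z → |y - z| < |x - y|)

lemma GreedyStable.swap {R B : Set ℝ} {G : SimpleGraph ℝ} (h : GreedyStable R B G) :
    GreedyStable B R G :=
  ⟨h.toWeaklyStable.swap, fun x hx y hy => by
    rw [G.adj_comm, abs_sub_comm x y]
    have := h.greedy y hy x hx
    tauto⟩

lemma encard_le_two_of_closer {S : Set ℝ} {x : ℝ}
    (htie : ∀ y ∈ S, ∀ z ∈ S, |x - y| = |x - z| → y = z)
    (hS : ∀ y ∈ S, {z | z ∈ S ∧ |x - z| < |x - y|}.encard < 2) : S.encard ≤ 2 := by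
  by_contra! hc
  have h3 : (3 : ℕ∞) ≤ S.encard := by
    have := Order.add_one_le_of_lt hc
    norm_num at this
    exact this
  obtain ⟨t, htS, ht⟩ := Set.exists_subset_encard_eq h3
  have htf : t.Finite := Set.finite_of_encard_eq_coe (k := 3) ht
  have htn : t.Nonempty := by
    rw [← Set.encard_pos, ht]; norm_num
  obtain ⟨y, hy, hmax⟩ := Set.exists_max_image t (fun y => |x - y|) htf htn
  have hsub : t \ {y} ⊆ {z | z ∈ S ∧ |x - z| < |x - y|} := by
    rintro z ⟨hz, hzy⟩
    exact ⟨htS hz, lt_of_le_of_ne (hmax z hz) fun e => hzy (htie _ (htS hz) _ (htS hy) e)⟩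
  have h4 := Set.encard_sdiff_singleton_add_one hy
  rw [ht] at h4
  have h5 : (t \ {y}).encard = 2 := by
    have : (3 : ℕ∞) = 2 + 1 := by norm_num
    rw [this] at h4
    exact ENat.add_left_injective_of_ne_top (n := 1) (by simp) h4
  have := (Set.encard_le_encard hsub).trans_lt (hS y (htS hy))
  rw [h5] at this
  exact lt_irrefl _ this

/-- The greedy graph: a pair is linked if neither of its members has two links to closer points. -/
lemma WellSpread.exists_greedyStable {R B : Set ℝ} (h : WellSpread R B) :
    ∃ G, GreedyStable R B G := by
  classical
  -- the set of linked pairs, by recursion over `Precedes`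
  obtain ⟨E, hE⟩ : ∃ E : ℝ × ℝ → Prop, ∀ e, E e ↔
      {y | Precedes R B (e.1, y) e ∧ E (e.1, y)}.encard < 2 ∧
      {x | Precedes R B (x, e.2) e ∧ E (x, e.2)}.encard < 2 := by
    refine ⟨h.wellFounded_precedes.fix (C := fun _ => Prop) fun e ih =>
      {y | ∃ hy : Precedes R B (e.1, y) e, ih (e.1, y) hy}.encard < 2 ∧
      {x | ∃ hx : Precedes R B (x, e.2) e, ih (x, e.2) hx}.encard < 2, fun e => ?_⟩
    conv_lhs => rw [WellFounded.fix_eq]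
    simp only [exists_prop]
  let G : SimpleGraph ℝ :=
    { Adj := fun x y => (x ∈ R ∧ y ∈ B ∧ E (x, y)) ∨ (x ∈ B ∧ y ∈ R ∧ E (y, x))
      symm := ⟨fun x y hxy => by tauto⟩
      loopless := ⟨fun x hx => by
        rcases hx with hx | hx
        · exact h.disj.le_bot ⟨hx.1, hx.2.1⟩
        · exact h.disj.le_bot ⟨hx.2.1, hx.1⟩⟩ }
  have hadj : ∀ x y, G.Adj x y ↔ (x ∈ R ∧ y ∈ B ∧ E (x, y)) ∨ (x ∈ B ∧ y ∈ R ∧ E (y, x)) :=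
    fun x y => Iff.rfl
  have hnR : ∀ x ∈ R, ∀ y, G.Adj x y ↔ y ∈ B ∧ E (x, y) := fun x hx y => by
    have : x ∉ B := fun hb => h.disj.le_bot ⟨hx, hb⟩
    rw [hadj]; tauto
  have hnB : ∀ x ∈ B, ∀ y, G.Adj x y ↔ y ∈ R ∧ E (y, x) := fun x hx y => by
    have : x ∉ R := fun hb => h.disj.le_bot ⟨hb, hx⟩
    rw [hadj]; tauto
  have hdeg : ∀ x, (G.neighborSet x).encard ≤ 2 := by
    intro x
    by_cases hx : x ∈ R
    · refine encard_le_two_of_closer (x := x) ?_ ?_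
      · intro y hy z hz
        exact h.no_tie_red x hx y ((hnR x hx y).1 hy).1 z ((hnR x hx z).1 hz).1
      · intro y hy
        obtain ⟨hyB, hyE⟩ := (hnR x hx y).1 hy
        refine lt_of_le_of_lt (Set.encard_le_encard ?_) ((hE _).1 hyE).1
        rintro z ⟨hz, hlt⟩
        obtain ⟨hzB, hzE⟩ := (hnR x hx z).1 hz
        exact ⟨⟨⟨hx, hzB⟩, ⟨hx, hyB⟩, .inl rfl, hlt⟩, hzE⟩
    · by_cases hx' : x ∈ B
      · refine encard_le_two_of_closer (x := x) ?_ ?_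
        · intro y hy z hz
          exact h.no_tie_blue x hx' y ((hnB x hx' y).1 hy).1 z ((hnB x hx' z).1 hz).1
        · intro y hy
          obtain ⟨hyB, hyE⟩ := (hnB x hx' y).1 hy
          refine lt_of_le_of_lt (Set.encard_le_encard ?_) ((hE _).1 hyE).2
          rintro z ⟨hz, hlt⟩
          obtain ⟨hzB, hzE⟩ := (hnB x hx' z).1 hz
          rw [abs_sub_comm x z, abs_sub_comm x y] at hlt
          exact ⟨⟨⟨hzB, hx'⟩, ⟨hyB, hx'⟩, .inr rfl, hlt⟩, hzE⟩
      · have : G.neighborSet x = ∅ := by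
          ext y
          simp only [SimpleGraph.mem_neighborSet, hadj]
          simp [hx, hx']
        simp [this]
  have hfull : ∀ x (T : Set ℝ), T ⊆ G.neighborSet x → ¬ T.encard < 2 →
      (G.neighborSet x).encard = 2 ∧ ∀ z, G.Adj x z → z ∈ T := by
    intro x T hT hT2
    rw [not_lt] at hT2
    -- two links to closer points exhaust the neighbors, as the degree is at most two
    have hfin : T.Finite :=
      (Set.finite_of_encard_le_coe (k := 2) (hdeg x)).subset hT
    have e := hfin.eq_of_subset_of_encard_le hT ((hdeg x).trans hT2)
    exact ⟨le_antisymm (hdeg x) (by rw [← e]; exact hT2), fun z hz => by rw [e]; exact hz⟩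
  have hgreedy : ∀ x ∈ R, ∀ y ∈ B, G.Adj x y ∨
      ((G.neighborSet x).encard = 2 ∧ ∀ z, G.Adj x z → |x - z| < |x - y|) ∨
      ((G.neighborSet y).encard = 2 ∧ ∀ z, G.Adj y z → |y - z| < |x - y|) := by
    intro x hx y hy
    by_cases hxy : E (x, y)
    · exact .inl ((hnR x hx y).2 ⟨hy, hxy⟩)
    rw [hE, not_and_or] at hxy
    rcases hxy with hxy | hxy
    · obtain ⟨h1, h2⟩ := hfull x _ (fun z hz => (hnR x hx z).2 ⟨hz.1.1.2, hz.2⟩) hxy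
      exact .inr (.inl ⟨h1, fun z hz => (h2 z hz).1.2.2.2⟩)
    · obtain ⟨h1, h2⟩ := hfull y _ (fun z hz => (hnB y hy z).2 ⟨hz.1.1.1, hz.2⟩) hxy
      exact .inr (.inr ⟨h1, fun z hz => by
        have := (h2 z hz).1.2.2.2
        rwa [abs_sub_comm y z]⟩)
  refine ⟨G, ⟨⟨h.disj, ?_, hdeg, ?_⟩, hgreedy⟩⟩
  · intro x y hxy
    rw [hadj] at hxy; tauto
  · intro x hx y hy z w hxz hyw h1 h2
    rcases hgreedy x hx y hy with h3 | h3 | h3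
    · exact h3
    · exact absurd (h3.2 z hxz) (not_lt.2 h1.le)
    · exact absurd (h3.2 w hyw) (not_lt.2 h2.le)

/-- If the walk makes high excursions of blue points, all red points get degree two in the greedy
graph: around a red point of smaller degree, the blue points to its right that cause the excursion
are matched within their distance to it, whereas some of their edges have to be long. -/
lemma GreedyStable.encard_neighborSet {R B : Set ℝ} {G : SimpleGraph ℝ} (h : GreedyStable R B G)
    (hR : ∀ a b, (R ∩ Set.Icc a b).Finite) (hB : ∀ a b, (B ∩ Set.Icc a b).Finite)
    (hexc : ∀ M : ℤ, ∀ K : ℝ, ∃ L ≥ K, ∀ t, L ≤ |t| → |t| ≤ 4 * L → M ≤ walk B R t)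
    {x : ℝ} (hx : x ∈ R) : (G.neighborSet x).encard = 2 := by
  classical
  by_contra hne
  have hblue : ∀ y ∈ B, ¬ G.Adj x y →
      (G.neighborSet y).encard = 2 ∧ ∀ z, G.Adj y z → |y - z| < |x - y| := by
    intro y hy hxy
    have := h.greedy x hx y hy
    tauto
  obtain ⟨L, hLK, hL⟩ := hexc (walk B R x + 3) (|x| + 1)
  have hxL : |x| < L := by linarith
  have hLpos := (abs_nonneg x).trans_lt hxL
  rw [abs_lt] at hxL
  let F : Set (ℝ × ℝ) := {e | e.1 ∈ B ∧ G.Adj e.1 e.2 ∧ x < e.1 ∧ ¬ G.Adj x e.1}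
  obtain ⟨⟨p, q⟩, ⟨hp, hpq, hxp, hnp⟩, hpL, hLq⟩ :=
    h.swap.exists_long_edge hB (F := F) (x := x) (l := L) (u := 4 * L) (by linarith)
      (fun e he => ⟨he.1, he.2.1, he.2.2.1⟩) (by
    intro s hs1 hs2
    have hRf := finite_inter_Ioc hR x s
    have hBf := finite_inter_Ioc hB x s
    obtain ⟨O, hO, hcard⟩ := h.exists_leaving_edges hBf.toFinset hRf.toFinset (h.nbrs x)
      fun p hp hpx => (hblue p ((hBf.mem_toFinset.1 hp).1) (by simpa using hpx)).1
    have h1 := h.card_nbrs_le x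
    have h3 : 3 ≤ excess B R x s := by
      rw [← walk_sub hB hR (by linarith)]
      have e : |s| = s := abs_of_pos (by linarith)
      have := hL s (by rwa [e]) (by rwa [e])
      omega
    simp only [excess, Set.ncard_eq_toFinset_card _ hRf, Set.ncard_eq_toFinset_card _ hBf] at h3
    obtain ⟨e, he, e', he', hne⟩ := Finset.one_lt_card.1 (show 1 < O.card by omega)
    have key : ∀ e ∈ O, e ∈ F ∧ e.1 ≤ s ∧ s < e.2 := by
      rintro ⟨p, q⟩ he
      obtain ⟨h1, h2, h3, h4⟩ := hO _ he
      rw [hBf.mem_toFinset] at h1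
      rw [hRf.mem_toFinset] at h4
      simp only [WeaklyStable.mem_nbrs] at h1 h2 h3 h4
      obtain ⟨hp, hxp, hps⟩ := h1
      have hq := h.red_of_adj h3 hp
      have hlt := (hblue p hp h2).2 q h3
      refine ⟨⟨hp, h3, hxp, h2⟩, hps, ?_⟩
      by_contra! hc
      refine h4 ⟨hq, ?_, hc⟩
      rw [abs_of_neg (by linarith : x - p < 0)] at hlt
      linarith [(abs_lt.1 hlt).2]
    exact ⟨e, (key e he).1, e', (key e' he').1, hne, (key e he).2, (key e' he').2⟩)
  simp only at *
  have hlt := (hblue p hp hnp).2 q hpq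
  rw [abs_of_neg (by linarith), abs_of_neg (by linarith)] at hlt
  linarith

lemma IsStableMultiMatching.fullyStable {R B : Set ℝ} {G : SimpleGraph ℝ} (h : WellSpread R B)
    (hG : IsStableMultiMatching R B (fun _ => 2) (fun _ => 2) G) : FullyStable R B G := by
  refine ⟨⟨h.disj, hG.bipartite, fun x => ?_, ?_⟩, h.finR, h.finB, hG.degree_red, hG.degree_blue⟩
  · by_cases hx : x ∈ R
    · exact (hG.degree_red x hx).le
    · by_cases hx' : x ∈ B
      · exact (hG.degree_blue x hx').le
      · have : G.neighborSet x = ∅ := by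
          ext y
          simp only [SimpleGraph.mem_neighborSet, Set.mem_empty_iff_false, iff_false]
          intro hxy
          have := hG.bipartite x y hxy
          tauto
        simp [this]
  · intro x hx y hy z w hxz hyw h1 h2
    have hne : x ≠ y := fun e => h.disj.le_bot ⟨hx, e ▸ hy⟩
    rcases hG.stable x hx y hy hne with h3 | h3 | h3
    · exact h3
    · exact absurd (h3 z hxz) (not_le.2 h1)
    · exact absurd (h3 w hyw) (not_le.2 h2)

/-- An edge of one stable multi-matching that is missing in another one forces a preceding edge of
the other one that is missing in the first one. -/
lemma WellSpread.exists_precedes {R B : Set ℝ} (h : WellSpread R B) {G G' : SimpleGraph ℝ}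
    (hG : IsStableMultiMatching R B (fun _ => 2) (fun _ => 2) G)
    (hG' : IsStableMultiMatching R B (fun _ => 2) (fun _ => 2) G') {x y : ℝ} (hx : x ∈ R)
    (hy : y ∈ B) (hxy : G.Adj x y) (hxy' : ¬ G'.Adj x y) :
    ∃ e : ℝ × ℝ, Precedes R B e (x, y) ∧ G'.Adj e.1 e.2 ∧ ¬ G.Adj e.1 e.2 := by
  have hF := hG.fullyStable h
  have hF' := hG'.fullyStable h
  have key : ∀ u w, G.Adj u w → ¬ G'.Adj u w → ∃ z, G'.Adj u z ∧ ¬ G.Adj u z := by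
    intro u w huw huw'
    by_contra! hc
    have e := (hF'.finite_neighborSet u).eq_of_subset_of_encard_le (t := G.neighborSet u)
      (fun z hz => hc z hz) (by
        rw [hF.degree_of_adj u w huw]
        obtain ⟨z, hz⟩ : ∃ z, G'.Adj u z := by
          rcases hF.bip _ _ huw with h1 | h1
          · have := hF'.degR u h1.1
            obtain ⟨z, hz⟩ := Set.nonempty_of_encard_ne_zero (s := G'.neighborSet u)
              (by rw [this]; norm_num)
            exact ⟨z, hz⟩
          · have := hF'.degB u h1.1
            obtain ⟨z, hz⟩ := Set.nonempty_of_encard_ne_zero (s := G'.neighborSet u)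
              (by rw [this]; norm_num)
            exact ⟨z, hz⟩
        exact (hF'.degree_of_adj u z hz).ge)
    have : w ∈ G.neighborSet u := huw
    rw [← e] at this
    exact huw' this
  have hne : x ≠ y := fun e => h.disj.le_bot ⟨hx, e ▸ hy⟩
  rcases hG'.stable x hx y hy hne with h3 | h3 | h3
  · exact absurd h3 hxy'
  · obtain ⟨z, hz, hz'⟩ := key x y hxy hxy'
    have hzB := hF'.blue_of_adj hz hx
    refine ⟨(x, z), ⟨⟨hx, hzB⟩, ⟨hx, hy⟩, .inl rfl, lt_of_le_of_ne (h3 z hz) fun e => ?_⟩, hz, hz'⟩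
    have := h.no_tie_red x hx z hzB y hy e
    exact hxy' (this ▸ hz)
  · obtain ⟨z, hz, hz'⟩ := key y x hxy.symm fun e => hxy' e.symm
    have hzR := hF'.red_of_adj hz hy
    refine ⟨(z, y), ⟨⟨hzR, hy⟩, ⟨hx, hy⟩, .inr rfl, lt_of_le_of_ne ?_ fun e => ?_⟩, hz.symm,
      fun e => hz' e.symm⟩
    · have := h3 z hz
      rwa [abs_sub_comm] at this
    · have e' : |z - y| = |x - y| := e
      rw [abs_sub_comm z, abs_sub_comm x] at e'
      have := h.no_tie_blue y hy z hzR x hx e'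
      exact hxy' (this ▸ hz.symm)

/-- On well-spread point sets, there is exactly one stable multi-matching with all degrees two, and
its components are finite. -/
theorem WellSpread.existsUnique_and_finite {R B : Set ℝ} (h : WellSpread R B) :
    (∃! G : SimpleGraph ℝ, IsStableMultiMatching R B (fun _ => 2) (fun _ => 2) G) ∧
      ∀ G : SimpleGraph ℝ, IsStableMultiMatching R B (fun _ => 2) (fun _ => 2) G →
        ∀ c : G.ConnectedComponent, c.supp.Finite := by
  refine ⟨?_, ?_⟩
  · obtain ⟨G, hG⟩ := h.exists_greedyStable
    have hGs : IsStableMultiMatching R B (fun _ => 2) (fun _ => 2) G := by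
      refine ⟨⟨hG.bip, fun x hx => hG.encard_neighborSet h.finR h.finB h.exc_blue hx,
        fun x hx => hG.swap.encard_neighborSet h.finB h.finR h.exc_red hx⟩, ?_⟩
      intro x hx y hy _
      rcases hG.greedy x hx y hy with h1 | h1 | h1
      · exact .inl h1
      · exact .inr (.inl fun z hz => (h1.2 z hz).le)
      · exact .inr (.inr fun z hz => (h1.2 z hz).le)
    refine ⟨G, hGs, fun G' hG' => ?_⟩
    have hagree : ∀ e : ℝ × ℝ, e.1 ∈ R → e.2 ∈ B → (G'.Adj e.1 e.2 ↔ G.Adj e.1 e.2) := by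
      intro e
      induction e using h.wellFounded_precedes.induction with
      | _ e ih =>
        intro h1 h2
        by_contra hne
        by_cases h3 : G.Adj e.1 e.2
        · obtain ⟨e', he', h4, h5⟩ := h.exists_precedes hGs hG' h1 h2 h3 (by tauto)
          exact h5 ((ih e' he' he'.1.1 he'.1.2).1 h4)
        · obtain ⟨e', he', h4, h5⟩ := h.exists_precedes hG' hGs h1 h2 (by tauto) h3
          exact h5 ((ih e' he' he'.1.1 he'.1.2).2 h4)
    ext x y
    have h1 := hG'.bipartite x y
    have h2 := hGs.bipartite x y
    have h3 := hagree (x, y)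
    have h4 := hagree (y, x)
    simp only [G.adj_comm y x, G'.adj_comm y x] at h4
    tauto
  · intro G hG c
    induction c using SimpleGraph.ConnectedComponent.ind with
    | _ u =>
      refine ((hG.fullyStable h).finite_component h.exc_red u).subset fun w hw => ?_
      rw [SimpleGraph.ConnectedComponent.mem_supp_iff, SimpleGraph.ConnectedComponent.eq] at hw
      exact hw.symm

/-! ### Long excursions of random walks -/

section Excursions

open Filter Finset
open scoped Topology

variable {Ω : Type*}

/-- The sum `-Y 0 + Y 1 - Y 2 + ⋯` of `m` terms. -/
noncomputable def altSum (Y : ℕ → Ω → ℝ) (m : ℕ) (ω : Ω) : ℝ :=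
  ∑ j ∈ range m, (-1) ^ (j + 1) * Y j ω

lemma altSum_add (Y : ℕ → Ω → ℝ) (n m : ℕ) (ω : Ω) : altSum Y (n + m) ω =
    altSum Y n ω + ∑ j ∈ range m, (-1) ^ (n + j + 1) * Y (n + j) ω := by
  simp only [altSum, sum_range_add]

lemma altSum_two_mul (Y : ℕ → Ω → ℝ) (n : ℕ) (ω : Ω) : altSum Y (2 * n) ω =
    ∑ k ∈ range n, Y (2 * k + 1) ω + ∑ k ∈ range n, -Y (2 * k) ω := by
  induction n with
  | zero => simp [altSum]
  | succ n ih =>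
    rw [show 2 * (n + 1) = 2 * n + 1 + 1 by ring, altSum, sum_range_succ, sum_range_succ,
      ← altSum, ih, sum_range_succ, sum_range_succ]
    simp only [pow_succ, pow_mul]
    ring

/-- The events that concern only the variables with index in `S`. -/
abbrev sigmaOf (X : ℕ → Ω → ℝ) (S : Set ℕ) : MeasurableSpace Ω :=
  ⨆ i ∈ S, MeasurableSpace.comap (X i) inferInstance

lemma measurable_sigmaOf (X : ℕ → Ω → ℝ) {S : Set ℕ} {i : ℕ} (hi : i ∈ S) :
    Measurable[sigmaOf X S] (X i) :=
  Measurable.mono (comap_measurable (X i))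
    (le_iSup₂ (f := fun i (_ : i ∈ S) => MeasurableSpace.comap (X i) inferInstance) i hi) le_rfl

lemma measurable_sum_sigmaOf (X : ℕ → Ω → ℝ) {S : Set ℕ} (F : Finset ℕ) (f : ℕ → ℕ) (c : ℕ → ℝ)
    (hf : ∀ j ∈ F, f j ∈ S) : Measurable[sigmaOf X S] (fun ω => ∑ j ∈ F, c j * X (f j) ω) := by
  refine Finset.measurable_fun_sum _ fun j hj => ?_
  exact Measurable.const_mul (measurable_sigmaOf X (hf j hj)) (c j)

variable [mΩ : MeasurableSpace Ω] {P : Measure Ω}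

lemma measure_inter_of_sigmaOf {X : ℕ → Ω → ℝ} (hind : iIndepFun X P)
    (hmeas : ∀ n, Measurable (X n)) {S T : Set ℕ} (hST : Disjoint S T) {A B : Set Ω}
    (hA : MeasurableSet[sigmaOf X S] A) (hB : MeasurableSet[sigmaOf X T] B) :
    P (A ∩ B) = P A * P B :=
  (Indep_iff _ _ _).1 (indep_iSup_of_disjoint (fun i => (hmeas i).comap_le) hind.iIndep hST) A B
    hA hB

variable [IsProbabilityMeasure P]

/-- By the central limit theorem, a centered random walk exceeds any multiple of its standard
deviation with probability bounded below. -/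
lemma exists_le_measure_sqrt_le_sum {Y : ℕ → Ω → ℝ} (hind : iIndepFun Y P)
    (hident : ∀ n, IdentDistrib (Y n) (Y 0) P P) (h2 : MemLp (Y 0) 2 P) (h0 : P[Y 0] = 0)
    (hv : Var[Y 0; P] ≠ 0) (a : ℝ) :
    ∃ c : ℝ≥0∞, c ≠ 0 ∧ ∀ᶠ n : ℕ in atTop, c ≤ P {ω | a * √n ≤ ∑ k ∈ range n, Y k ω} := by
  have hY' : HasLaw id (gaussianReal 0 Var[Y 0; P].toNNReal)
      (gaussianReal 0 Var[Y 0; P].toNNReal) := ⟨aemeasurable_id, Measure.map_id⟩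
  have hclt := tendstoInDistribution_inv_sqrt_mul_sum_sub hY' h2 hind hident
  have hlim := ProbabilityMeasure.le_liminf_measure_open_of_tendsto hclt.tendsto (isOpen_Ioi (a := a))
  simp only [ProbabilityMeasure.coe_mk, Measure.map_id] at hlim
  have hv' : Var[Y 0; P].toNNReal ≠ 0 := by
    rw [Ne, Real.toNNReal_eq_zero, not_le]
    exact lt_of_le_of_ne (variance_nonneg _ _) hv.symm
  have hpos : gaussianReal 0 Var[Y 0; P].toNNReal (Set.Ioi a) ≠ 0 := by
    intro h
    have := gaussianReal_absolutelyContinuous' 0 hv' h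
    simp at this
  obtain ⟨c, hc0, hc⟩ := exists_between (pos_iff_ne_zero.2 hpos)
  refine ⟨c, hc0.ne', ?_⟩
  filter_upwards [eventually_lt_of_lt_liminf (hc.trans_le hlim), eventually_gt_atTop 0] with n hn hn0
  refine hn.le.trans ?_
  rw [Measure.map_apply_of_aemeasurable (hclt.forall_aemeasurable n) measurableSet_Ioi]
  refine measure_mono fun ω hω => ?_
  have hsq : 0 < √(n : ℝ) := Real.sqrt_pos.2 (by exact_mod_cast hn0)
  simp only [Set.mem_preimage, Set.mem_Ioi, h0, mul_zero, sub_zero] at hω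
  rw [inv_mul_eq_div, lt_div_iff₀ hsq] at hω
  exact hω.le

/-- **Kolmogorov's maximal inequality.** -/
lemma measure_exists_le_abs_sum_le {Y : ℕ → Ω → ℝ} (hind : iIndepFun Y P)
    (hmeas : ∀ n, Measurable (Y n)) (h2 : ∀ n, MemLp (Y n) 2 P) (h0 : ∀ n, P[Y n] = 0)
    {h : ℝ} (hh : 0 < h) (n : ℕ) :
    P {ω | ∃ m ≤ n, h ≤ |∑ j ∈ range m, Y j ω|} ≤
      ENNReal.ofReal ((∑ j ∈ range (n + 1), Var[Y j; P]) / h ^ 2) := by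
  let S : ℕ → Ω → ℝ := fun m ω => ∑ j ∈ range (m + 1), Y j ω
  have hS2 : ∀ m, MemLp (S m) 2 P := fun m => memLp_finsetSum _ fun j _ => h2 j
  have hSi : ∀ m, Integrable (fun ω => S m ω ^ 2) P := fun m => (hS2 m).integrable_sq
  have hsm : ∀ n, StronglyMeasurable (Y n) := fun n => (hmeas n).stronglyMeasurable
  let 𝒢 := Filtration.natural Y hsm
  have hSmeas : ∀ m, StronglyMeasurable[𝒢 m] (S m) := by
    intro m
    refine Finset.stronglyMeasurable_fun_sum _ fun j hj => ?_
    exact (Filtration.stronglyAdapted_natural hsm j).mono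
      (𝒢.mono (by simpa [Nat.lt_succ_iff] using hj))
  have hsub : Submartingale (fun m ω => S m ω ^ 2) 𝒢 P := by
    refine submartingale_of_setIntegral_le_succ (fun m => (hSmeas m).pow 2) hSi ?_
    intro m s hs
    have hs' : MeasurableSet s := 𝒢.le m s hs
    have hindep : IndepFun (s.indicator (S m)) (Y (m + 1)) P := by
      have h1 := hind.indep_comap_natural_of_lt hsm (Nat.lt_succ_self m)
      rw [IndepFun_iff_Indep]
      refine indep_of_indep_of_le_left h1.symm ?_
      exact (((hSmeas m).measurable).indicator hs).comap_le
    have hcross : ∫ ω in s, S m ω * Y (m + 1) ω ∂P = 0 := by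
      have h3 : ∫ ω, s.indicator (S m) ω * Y (m + 1) ω ∂P = 0 := by
        have := hindep.integral_mul_eq_mul_integral
          ((hS2 m).aestronglyMeasurable.indicator hs') (h2 (m + 1)).aestronglyMeasurable
        simp only [Pi.mul_apply] at this
        rw [this, h0, mul_zero]
      rw [← integral_indicator hs', ← h3]
      congr 1
      ext ω
      by_cases hω : ω ∈ s <;> simp [hω]
    have e : ∀ ω, S (m + 1) ω ^ 2 = S m ω ^ 2 + (2 * (S m ω * Y (m + 1) ω) + Y (m + 1) ω ^ 2) := by
      intro ω
      simp only [S]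
      rw [sum_range_succ _ (m + 1)]
      ring
    have hi2 : Integrable (fun ω => S m ω * Y (m + 1) ω) P := (hS2 m).integrable_mul (h2 (m + 1))
    simp only [e]
    have hi3 : Integrable (fun ω => 2 * (S m ω * Y (m + 1) ω) + Y (m + 1) ω ^ 2) P :=
      (hi2.const_mul 2).add (h2 (m + 1)).integrable_sq
    rw [integral_add (hSi m).integrableOn hi3.integrableOn,
      integral_add (hi2.const_mul 2).integrableOn (h2 (m + 1)).integrable_sq.integrableOn,
      integral_const_mul, hcross]
    have : 0 ≤ ∫ ω in s, Y (m + 1) ω ^ 2 ∂P := integral_nonneg fun ω => sq_nonneg _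
    linarith
  have hmax := maximal_ineq hsub (fun m ω => sq_nonneg _) (ε := (h ^ 2).toNNReal) n
  have hh2 : ((h ^ 2).toNNReal : ℝ) = h ^ 2 := Real.coe_toNNReal _ (by positivity)
  have hvar : ∫ ω, S n ω ^ 2 ∂P = ∑ j ∈ range (n + 1), Var[Y j; P] := by
    have h3 : P[S n] = 0 := by
      simp only [S]
      rw [integral_finsetSum _ fun j _ => (h2 j).integrable (by norm_num)]
      exact sum_eq_zero fun j _ => h0 j
    rw [← variance_of_integral_eq_zero (hS2 n).aestronglyMeasurable.aemeasurable h3]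
    have := IndepFun.variance_sum (μ := P) (X := Y) (s := range (n + 1)) (fun j _ => h2 j)
      (fun i _ j _ hij => hind.indepFun hij)
    rw [← this]
    congr 1
    ext ω
    simp [S]
  have hle : ENNReal.ofReal (h ^ 2) * P {ω | ∃ m ≤ n, h ≤ |∑ j ∈ range m, Y j ω|} ≤
      ENNReal.ofReal (∑ j ∈ range (n + 1), Var[Y j; P]) := by
    calc _ ≤ ENNReal.ofReal (h ^ 2) * P {ω | ((h ^ 2).toNNReal : ℝ) ≤
            (range (n + 1)).sup' nonempty_range_add_one fun k => S k ω ^ 2} := by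
          gcongr with ω
          rintro ⟨m, hm, hω⟩
          rw [hh2]
          rw [Finset.le_sup'_iff]
          rcases m with _ | m
          · simp only [range_zero, sum_empty, abs_zero] at hω
            linarith
          · refine ⟨m, by simp; omega, ?_⟩
            have := pow_le_pow_left₀ hh.le hω 2
            rwa [sq_abs] at this
      _ ≤ _ := by
          refine le_trans hmax ?_
          refine ENNReal.ofReal_le_ofReal ?_
          rw [← hvar]
          exact setIntegral_le_integral (hSi n) (ae_of_all _ fun ω => sq_nonneg _)
  rw [ENNReal.ofReal_div_of_pos (by positivity), ENNReal.le_div_iff_mul_le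
    (.inl (by simpa using hh.ne')) (.inl ENNReal.ofReal_ne_top), mul_comm]
  exact hle

/-- With probability bounded below, the walk `altSum Y` is high during a long time interval: with
`σ` the standard deviation of a term, its value at the time `2 * L` is at least `8 * σ * √L`, half
of it due to the terms of either sign, and thereafter it moves by less than half of that. -/
lemma exists_le_measure_altSum {Y : ℕ → Ω → ℝ} (hind : iIndepFun Y P)
    (hmeas : ∀ n, Measurable (Y n)) (hident : ∀ n, IdentDistrib (Y n) (Y 0) P P)
    (h2 : MemLp (Y 0) 2 P) (h0 : P[Y 0] = 0) (hv : Var[Y 0; P] ≠ 0) :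
    ∃ c : ℝ≥0∞, c ≠ 0 ∧ ∀ M : ℝ, ∀ᶠ L : ℕ in atTop,
      c ≤ P {ω | ∀ m, 2 * L ≤ m → m ≤ 8 * L + 2 → M ≤ altSum Y m ω} := by
  have h2' : ∀ n, MemLp (Y n) 2 P := fun n => (hident n).memLp_iff.2 h2
  have h0' : ∀ n, P[Y n] = 0 := fun n => by rw [(hident n).integral_eq, h0]
  have hv' : ∀ n, Var[Y n; P] = Var[Y 0; P] := fun n => (hident n).variance_eq
  set σ := √Var[Y 0; P] with hσ
  have hσpos : 0 < σ := Real.sqrt_pos.2 (lt_of_le_of_ne (variance_nonneg _ _) hv.symm)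
  have hσ2 : σ ^ 2 = Var[Y 0; P] := Real.sq_sqrt (variance_nonneg _ _)
  obtain ⟨c1, hc1, h1⟩ := exists_le_measure_sqrt_le_sum (Y := fun k => Y (2 * k + 1))
    (hind.precomp fun a b hab => by simpa using hab)
    (fun n => (hident _).trans (hident _).symm) (h2' _) (h0' _) (by rw [hv']; exact hv) (4 * σ)
  obtain ⟨c2, hc2, h2⟩ := exists_le_measure_sqrt_le_sum (Y := fun k ω => -Y (2 * k) ω)
    ((hind.precomp (g := fun k => 2 * k) fun a b hab => by simpa using hab).comp
      (fun _ x => -x) fun _ => measurable_neg)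
    (fun n => ((hident _).trans (hident _).symm).comp measurable_neg) (h2' _).neg
    (by rw [integral_neg, h0', neg_zero])
    (by rw [show (fun ω => -Y (2 * 0) ω) = -Y (2 * 0) from rfl, variance_neg, hv']; exact hv)
    (4 * σ)
  refine ⟨c1 * c2 * 2⁻¹, by simp [hc1, hc2], fun M => ?_⟩
  have hlarge : ∀ᶠ L : ℕ in atTop, M ≤ 4 * σ * √L :=
    (Tendsto.const_mul_atTop (by positivity)
      (Real.tendsto_sqrt_atTop.comp tendsto_natCast_atTop_atTop)).eventually_ge_atTop M
  filter_upwards [h1, h2, hlarge, eventually_ge_atTop 2] with L hL1 hL2 hLM hL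
  have hsq : 0 < √(L : ℝ) := Real.sqrt_pos.2 (by exact_mod_cast (by omega : 0 < L))
  set A := {ω | 4 * σ * √L ≤ ∑ k ∈ range L, Y (2 * k + 1) ω} with hA
  set B := {ω | 4 * σ * √L ≤ ∑ k ∈ range L, -Y (2 * k) ω} with hB
  set C := {ω | ∃ m ≤ 6 * L + 2,
    4 * σ * √L ≤ |∑ j ∈ range m, (-1) ^ (2 * L + j + 1) * Y (2 * L + j) ω|} with hC
  have hPC : P C ≤ 2⁻¹ := by
    have hvar : ∀ j, Var[fun ω => (-1) ^ (2 * L + j + 1) * Y (2 * L + j) ω; P] = σ ^ 2 := by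
      intro j
      rw [variance_const_mul, ← pow_mul, mul_comm _ 2, pow_mul, neg_one_sq, one_pow, one_mul, hv',
        hσ2]
    refine (measure_exists_le_abs_sum_le
      (Y := fun j ω => (-1) ^ (2 * L + j + 1) * Y (2 * L + j) ω)
      ((hind.precomp (g := fun j => 2 * L + j) fun a b hab => by simpa using hab).comp
        (fun j x => (-1) ^ (2 * L + j + 1) * x) fun _ => measurable_const_mul _)
      (fun j => (hmeas _).const_mul _) (fun j => (h2' _).const_mul _)
      (fun j => by rw [integral_const_mul, h0', mul_zero]) (by positivity) _).trans ?_
    rw [← ENNReal.ofReal_ofNat, ← ENNReal.ofReal_inv_of_pos (by norm_num)]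
    refine ENNReal.ofReal_le_ofReal ?_
    simp only [hvar, sum_const, card_range, nsmul_eq_mul]
    rw [mul_pow, Real.sq_sqrt (Nat.cast_nonneg _), div_le_iff₀ (by positivity)]
    have hL' : (2 : ℝ) ≤ L := by exact_mod_cast hL
    push_cast
    nlinarith [mul_nonneg (sq_nonneg σ) (by linarith : (0 : ℝ) ≤ 2 * L - 3)]
  have mA : MeasurableSet[sigmaOf Y {i | i < 2 * L ∧ i % 2 = 1}] A := by
    have := measurable_sum_sigmaOf Y (S := {i | i < 2 * L ∧ i % 2 = 1}) (range L)
      (fun k => 2 * k + 1) (fun _ => 1) (fun j hj => by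
        have := mem_range.1 hj
        simp only [Set.mem_ofPred_eq]; omega)
    simp only [one_mul] at this
    exact measurableSet_le measurable_const this
  have mB : MeasurableSet[sigmaOf Y {i | i < 2 * L ∧ i % 2 = 0}] B := by
    have := measurable_sum_sigmaOf Y (S := {i | i < 2 * L ∧ i % 2 = 0}) (range L)
      (fun k => 2 * k) (fun _ => -1) (fun j hj => by
        have := mem_range.1 hj
        simp only [Set.mem_ofPred_eq]; omega)
    simp only [neg_mul, one_mul] at this
    exact measurableSet_le measurable_const this
  have mC : MeasurableSet[sigmaOf Y {i | 2 * L ≤ i}] C := by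
    have e : C = ⋃ m ∈ {m | m ≤ 6 * L + 2}, {ω | 4 * σ * √L ≤
        |∑ j ∈ range m, (-1) ^ (2 * L + j + 1) * Y (2 * L + j) ω|} := by
      ext ω; simp [hC]
    rw [e]
    refine MeasurableSet.biUnion (Set.to_countable _) fun m _ => ?_
    have := measurable_sum_sigmaOf Y (S := {i | 2 * L ≤ i}) (range m)
      (fun j => 2 * L + j) (fun j => (-1) ^ (2 * L + j + 1)) (fun j hj => by
        simp only [Set.mem_ofPred_eq]; omega)
    exact measurableSet_le measurable_const (continuous_abs.measurable.comp this)
  have hmono : ∀ {S T : Set ℕ}, S ⊆ T → sigmaOf Y S ≤ sigmaOf Y T := fun hST =>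
    biSup_mono hST
  have hAB : P (A ∩ B) = P A * P B := measure_inter_of_sigmaOf hind hmeas (by
    rw [Set.disjoint_left]; intro i hi hi'
    simp only [Set.mem_ofPred_eq] at hi hi'; omega) mA mB
  have mAB : MeasurableSet[sigmaOf Y {i | i < 2 * L}] (A ∩ B) :=
    MeasurableSet.inter (hmono (fun i hi => hi.1) _ mA) (hmono (fun i hi => hi.1) _ mB)
  have hABC : P (A ∩ B ∩ Cᶜ) = P (A ∩ B) * P Cᶜ := measure_inter_of_sigmaOf hind hmeas (by
    rw [Set.disjoint_left]; intro i hi hi'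
    simp only [Set.mem_ofPred_eq] at hi hi'; omega) mAB mC.compl
  have hCm : MeasurableSet C := by
    refine (iSup₂_le fun i _ => (hmeas i).comap_le : sigmaOf Y {i | 2 * L ≤ i} ≤ mΩ) _ mC
  have hPC' : 2⁻¹ ≤ P Cᶜ := by
    rw [prob_compl_eq_one_sub hCm]
    refine le_trans ?_ (tsub_le_tsub_left hPC 1)
    rw [ENNReal.one_sub_inv_two]
  calc c1 * c2 * 2⁻¹ ≤ P A * P B * P Cᶜ := by gcongr
    _ = P (A ∩ B ∩ Cᶜ) := by rw [hABC, hAB]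
    _ ≤ _ := by
      refine measure_mono ?_
      rintro ω ⟨⟨hωA, hωB⟩, hωC⟩ m hm1 hm2
      obtain ⟨k, rfl⟩ := Nat.exists_eq_add_of_le hm1
      simp only [hA, hB, hC, Set.mem_ofPred_eq, Set.mem_compl_iff, not_exists, not_and,
        not_le] at hωA hωB hωC
      have h3 := (abs_lt.1 (hωC k (by omega))).1
      rw [altSum_add, altSum_two_mul]
      linarith

/-- The even and the odd half of an independent sequence almost surely have arbitrarily high
alternating sums simultaneously, during arbitrarily late and long time intervals.  At each late
scale, this has a probability bounded below, and the whole event is a tail event because finitely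
many terms change the sums by a bounded amount only. -/
theorem ae_exists_altSum_ge {X : ℕ → Ω → ℝ} (hind : iIndepFun X P)
    (hmeas : ∀ n, Measurable (X n)) (hident : ∀ n, IdentDistrib (X n) (X 0) P P)
    (h2 : MemLp (X 0) 2 P) (h0 : P[X 0] = 0) (hv : Var[X 0; P] ≠ 0) :
    ∀ᵐ ω ∂P, ∀ M N : ℕ, ∃ L ≥ N, ∀ s < 2, ∀ m, 2 * L ≤ m → m ≤ 8 * L + 2 →
      (M : ℝ) ≤ altSum (fun j => X (2 * j + s)) m ω := by
  have hside : ∀ s : ℕ, ∃ c : ℝ≥0∞, c ≠ 0 ∧ ∀ M : ℝ, ∀ᶠ L : ℕ in atTop, c ≤ P {ω | ∀ m,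
      2 * L ≤ m → m ≤ 8 * L + 2 → M ≤ altSum (fun j => X (2 * j + s)) m ω} := fun s =>
    exists_le_measure_altSum
      (hind.precomp (g := fun j => 2 * j + s) fun a b hab => by simpa using hab)
      (fun n => hmeas _) (fun n => (hident _).trans (hident _).symm) ((hident _).memLp_iff.2 h2)
      (by rw [(hident _).integral_eq, h0]) (by rw [(hident _).variance_eq]; exact hv)
  obtain ⟨c0, hc0, hs0⟩ := hside 0
  obtain ⟨c1, hc1, hs1⟩ := hside 1
  -- the part of the sums that the first `n` terms do not influence
  let tailSum : ℕ → ℕ → ℕ → Ω → ℝ := fun n s m ω =>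
    ∑ j ∈ Ico n m, (-1) ^ (j + 1) * X (2 * j + s) ω
  have htail : ∀ n s m ω, n ≤ m → altSum (fun j => X (2 * j + s)) m ω =
      altSum (fun j => X (2 * j + s)) n ω + tailSum n s m ω := fun n s m ω hnm => by
    simp only [altSum, tailSum, sum_range_add_sum_Ico _ hnm]
  let G : ℕ → ℕ → ℕ → Set Ω := fun n M L =>
    {ω | ∀ s < 2, ∀ m, 2 * L ≤ m → m ≤ 8 * L + 2 → (M : ℝ) ≤ tailSum n s m ω}
  have mtail : ∀ n s m, ∀ S : Set ℕ, (∀ j, n ≤ j → 2 * j + s ∈ S) →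
      Measurable[sigmaOf X S] (tailSum n s m) := fun n s m S hS =>
    measurable_sum_sigmaOf X (Ico n m) (fun j => 2 * j + s) (fun j => (-1) ^ (j + 1))
      fun j hj => hS j (mem_Ico.1 hj).1
  have mG : ∀ n M L, MeasurableSet[sigmaOf X {i | n ≤ i}] (G n M L) := by
    intro n M L
    have e : G n M L = ⋂ s ∈ {s | s < 2}, ⋂ m ∈ {m | 2 * L ≤ m ∧ m ≤ 8 * L + 2},
        {ω | (M : ℝ) ≤ tailSum n s m ω} := by
      ext ω
      simp only [G, Set.mem_iInter, Set.mem_ofPred_eq, and_imp]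
    rw [e]
    refine MeasurableSet.biInter (Set.to_countable _) fun s _ =>
      MeasurableSet.biInter (Set.to_countable _) fun m _ => ?_
    refine measurableSet_le measurable_const (mtail n s m _ fun j hj => ?_)
    simp only [Set.mem_ofPred_eq]; omega
  let T : ℕ → Set Ω := fun n => {ω | ∀ M N : ℕ, ∃ L ≥ N, ω ∈ G n M L}
  have hT : ∀ n, T n = T 0 := by
    have key : ∀ n n' ω, ω ∈ T n → ω ∈ T n' := by
      intro n n' ω hω M N
      let d : ℕ → ℝ := fun s => altSum (fun j => X (2 * j + s)) n ω -
        altSum (fun j => X (2 * j + s)) n' ω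
      obtain ⟨M', hM'⟩ := exists_nat_ge (M + |d 0| + |d 1|)
      obtain ⟨L, hL, hLG⟩ := hω M' (max N (max n n'))
      have hL1 := (le_max_left N (max n n')).trans hL
      have hL2 := ((le_max_left n n').trans (le_max_right N _)).trans hL
      have hL3 := ((le_max_right n n').trans (le_max_right N _)).trans hL
      refine ⟨L, hL1, fun s hs m hm1 hm2 => ?_⟩
      have h3 := hLG s hs m hm1 hm2
      have h4 := htail n s m ω (by omega)
      have h5 := htail n' s m ω (by omega)
      have h6 := neg_abs_le (d s)
      have h7 : |d s| ≤ |d 0| + |d 1| := by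
        interval_cases s
        · linarith [abs_nonneg (d 1)]
        · linarith [abs_nonneg (d 0)]
      simp only [d] at h6
      linarith
    exact fun n => Set.Subset.antisymm (fun ω => key n 0 ω) fun ω => key 0 n ω
  have mT : ∀ n, MeasurableSet[sigmaOf X {i | n ≤ i}] (T n) := by
    intro n
    have e : T n = ⋂ M : ℕ, ⋂ N : ℕ, ⋃ L ∈ {L | N ≤ L}, G n M L := by
      ext ω; simp [T]
    rw [e]
    exact MeasurableSet.iInter fun M => MeasurableSet.iInter fun N =>
      MeasurableSet.biUnion (Set.to_countable _) fun L _ => mG n M L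
  have hle : ∀ S : Set ℕ, sigmaOf X S ≤ mΩ := fun S => iSup₂_le fun i _ => (hmeas i).comap_le
  have h01 : P (T 0) = 0 ∨ P (T 0) = 1 := by
    refine measure_zero_or_one_of_measurableSet_limsup_atTop (fun n => (hmeas n).comap_le)
      hind.iIndep ?_
    rw [limsup_eq_iInf_iSup_of_nat, MeasurableSpace.measurableSet_iInf]
    intro n
    rw [← hT n]
    exact mT n
  have hG : ∀ M : ℕ, ∀ᶠ L : ℕ in atTop, c0 * c1 ≤ P (G 0 M L) := by
    intro M
    filter_upwards [hs0 M, hs1 M] with L h3 h4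
    have hm : ∀ s, MeasurableSet[sigmaOf X {i | i % 2 = s % 2}]
        {ω | ∀ m, 2 * L ≤ m → m ≤ 8 * L + 2 → (M : ℝ) ≤ altSum (fun j => X (2 * j + s)) m ω} := by
      intro s
      have e : {ω | ∀ m, 2 * L ≤ m → m ≤ 8 * L + 2 →
          (M : ℝ) ≤ altSum (fun j => X (2 * j + s)) m ω} =
          ⋂ m ∈ {m | 2 * L ≤ m ∧ m ≤ 8 * L + 2},
            {ω | (M : ℝ) ≤ altSum (fun j => X (2 * j + s)) m ω} := by
        ext ω; simp
      rw [e]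
      refine MeasurableSet.biInter (Set.to_countable _) fun m _ =>
        measurableSet_le measurable_const ?_
      exact measurable_sum_sigmaOf X (range m) (fun j => 2 * j + s) (fun j => (-1) ^ (j + 1))
        fun j _ => by simp only [Set.mem_ofPred_eq]; omega
    calc c0 * c1 ≤ _ := mul_le_mul' h3 h4
      _ = _ := (measure_inter_of_sigmaOf hind hmeas (by
        rw [Set.disjoint_left]; intro i hi hi'
        simp only [Set.mem_ofPred_eq] at hi hi'; omega) (hm 0) (hm 1)).symm
      _ ≤ _ := by
        refine measure_mono ?_
        rintro ω ⟨hω0, hω1⟩ s hs m hm1 hm2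
        have h5 := htail 0 s m ω (Nat.zero_le _)
        simp only [altSum, range_zero, sum_empty, zero_add] at h5
        rw [← h5]
        interval_cases s
        · exact hω0 m hm1 hm2
        · exact hω1 m hm1 hm2
  have hpos : P (T 0) ≠ 0 := by
    let A : ℕ → Set Ω := fun n => ⋃ L ∈ {L | n ≤ L}, G 0 n L
    have hA : Antitone A := by
      intro n n' hn ω hω
      simp only [A, Set.mem_iUnion, Set.mem_ofPred_eq, exists_prop] at hω ⊢
      obtain ⟨L, hL, hω⟩ := hω
      refine ⟨L, hn.trans hL, fun s hs m hm1 hm2 => le_trans ?_ (hω s hs m hm1 hm2)⟩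
      exact_mod_cast hn
    have mA : ∀ n, MeasurableSet (A n) := fun n =>
      MeasurableSet.biUnion (Set.to_countable _) fun L _ => hle _ _ (mG 0 n L)
    have hlim := tendsto_measure_iInter_atTop (μ := P) (fun n => (mA n).nullMeasurableSet) hA
      ⟨0, measure_ne_top _ _⟩
    have hge : c0 * c1 ≤ P (⋂ n, A n) := by
      refine ge_of_tendsto' hlim fun n => ?_
      obtain ⟨L, hL, hL'⟩ := ((hG n).and (eventually_ge_atTop n)).exists
      exact hL.trans (measure_mono (Set.subset_biUnion_of_mem (u := fun L => G 0 n L) hL'))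
    have hsub : (⋂ n, A n) ⊆ T 0 := by
      intro ω hω M N
      have := Set.mem_iInter.1 hω (max M N)
      simp only [A, Set.mem_iUnion, Set.mem_ofPred_eq, exists_prop] at this
      obtain ⟨L, hL, hω⟩ := this
      refine ⟨L, (le_max_right M N).trans hL, fun s hs m hm1 hm2 =>
        le_trans ?_ (hω s hs m hm1 hm2)⟩
      exact_mod_cast le_max_left M N
    intro h
    have h3 := hge.trans (measure_mono hsub)
    rw [h, nonpos_iff_eq_zero, mul_eq_zero] at h3
    tauto
  have h1 : P (T 0) = 1 := h01.resolve_left hpos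
  have hae : ∀ᵐ ω ∂P, ω ∈ T 0 := (mem_ae_iff_prob_eq_one (hle _ _ (mT 0))).2 h1
  filter_upwards [hae] with ω hω M N
  obtain ⟨L, hL, hω⟩ := hω M N
  refine ⟨L, hL, fun s hs m hm1 hm2 => ?_⟩
  have h5 := htail 0 s m ω (Nat.zero_le _)
  have h6 := hω s hs m hm1 hm2
  simp only [altSum, range_zero, sum_empty, zero_add] at h5 ⊢
  rw [h5]
  exact h6

end Excursions

/-! ### One-dimensional laws of a Poisson process -/

theorem poissonMeasure_compl_zero_le (r : ℝ≥0) : poissonMeasure r {0}ᶜ ≤ r := by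
  rw [prob_compl_eq_one_sub (MeasurableSet.singleton 0), poissonMeasure_singleton]
  have h := Real.add_one_le_exp (-(r : ℝ))
  rw [tsub_le_iff_right, ← ENNReal.ofReal_coe_nnreal, ← ENNReal.ofReal_add (by positivity)
    (by positivity), ← ENNReal.ofReal_one]
  apply ENNReal.ofReal_le_ofReal
  simp only [pow_zero, Nat.factorial_zero, Nat.cast_one, mul_one, div_one]
  linarith

theorem poissonMeasure_compl_zero_one_le (r : ℝ≥0) :
    poissonMeasure r ({0, 1} : Set ℕ)ᶜ ≤ (r : ℝ≥0∞) ^ 2 := by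
  have hd : Disjoint ({0} : Set ℕ) {1} := by simp
  rw [prob_compl_eq_one_sub MeasurableSet.of_discrete, Set.insert_eq,
    measure_union hd (MeasurableSet.singleton 1), poissonMeasure_singleton,
    poissonMeasure_singleton]
  have h := Real.add_one_le_exp (-(r : ℝ))
  have hr : (0 : ℝ) ≤ r := r.2
  rw [tsub_le_iff_right, ← ENNReal.ofReal_coe_nnreal, ← ENNReal.ofReal_pow (by positivity),
    ← ENNReal.ofReal_add (by positivity) (by positivity),
    ← ENNReal.ofReal_add (by positivity) (by positivity), ← ENNReal.ofReal_one]
  apply ENNReal.ofReal_le_ofReal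
  simp only [pow_zero, Nat.factorial_zero, Nat.cast_one, mul_one, div_one, pow_one,
    Nat.factorial_one]
  nlinarith

theorem memLp_two_cast_poissonMeasure (r : ℝ≥0) :
    MemLp (fun n : ℕ => (n : ℝ)) 2 (poissonMeasure r) := by
  rw [memLp_two_iff_integrable_sq (by fun_prop), integrable_poissonMeasure_iff]
  have hs : Summable fun n : ℕ => Real.exp (-r) * ((4 * (r : ℝ)) ^ n / n.factorial) :=
    (Real.summable_pow_div_factorial _).mul_left _
  refine Summable.of_nonneg_of_le (fun n => by positivity) (fun n => ?_) hs
  have h2 : ((n : ℝ)) ≤ 2 ^ n := by exact_mod_cast n.lt_two_pow_self.le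
  have h4 : ((n : ℝ)) ^ 2 ≤ 4 ^ n := by
    calc ((n : ℝ)) ^ 2 ≤ (2 ^ n) ^ 2 := by gcongr
      _ = 4 ^ n := by rw [← pow_mul, mul_comm, pow_mul]; norm_num
  rw [Real.norm_of_nonneg (by positivity), mul_pow]
  calc Real.exp (-r) * (r : ℝ) ^ n / n.factorial * (n : ℝ) ^ 2
      ≤ Real.exp (-r) * (r : ℝ) ^ n / n.factorial * 4 ^ n := by gcongr
    _ = _ := by ring

section Law

variable {Ω : Type*} [MeasurableSpace Ω] {P : Measure Ω} {lam : ℝ≥0} {N : Ω → Measure ℝ}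
  {A A' : Set ℝ}

namespace IsPoissonProcess

theorem measurable_apply (h : IsPoissonProcess P lam N) (hA : MeasurableSet A) :
    Measurable fun ω => N ω A :=
  (Measure.measurable_coe hA).comp h.measurable

theorem measure_apply_mem (h : IsPoissonProcess P lam N) (hA : MeasurableSet A)
    (hA' : volume A ≠ ∞) {S : Set ℝ≥0∞} (hS : MeasurableSet S) :
    P {ω | N ω A ∈ S} =
      poissonMeasure (lam * (volume A).toNNReal) {n : ℕ | (n : ℝ≥0∞) ∈ S} := by
  have h1 := congrArg (fun μ => μ S) (h.hasLaw A hA hA')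
  rw [Measure.map_apply (h.measurable_apply hA) hS, Measure.map_apply .of_discrete hS] at h1
  exact h1

theorem ae_exists_nat (h : IsPoissonProcess P lam N) (hA : MeasurableSet A)
    (hA' : volume A ≠ ∞) : ∀ᵐ ω ∂P, ∃ n : ℕ, N ω A = n := by
  have hS : MeasurableSet (Set.range fun n : ℕ => (n : ℝ≥0∞)) :=
    (Set.countable_range _).measurableSet
  have h1 := h.measure_apply_mem hA hA' hS.compl
  have h2 : {n : ℕ | (n : ℝ≥0∞) ∈ (Set.range fun n : ℕ => (n : ℝ≥0∞))ᶜ} = ∅ := by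
    ext n; simp
  rw [h2, measure_empty] at h1
  rw [ae_iff]
  convert! h1 using 3
  ext ω
  simp [eq_comm]

theorem measure_ne_zero_le (h : IsPoissonProcess P lam N) (hA : MeasurableSet A)
    (hA' : volume A ≠ ∞) : P {ω | N ω A ≠ 0} ≤ lam * volume A := by
  have h1 := h.measure_apply_mem hA hA' (MeasurableSet.singleton (0 : ℝ≥0∞)).compl
  have h2 := poissonMeasure_compl_zero_le (lam * (volume A).toNNReal)
  rw [ENNReal.coe_mul, ENNReal.coe_toNNReal hA'] at h2
  have h3 : {n : ℕ | (n : ℝ≥0∞) ∈ ({0}ᶜ : Set ℝ≥0∞)} = {0}ᶜ := by ext n; simp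
  rw [h3] at h1
  exact h1.trans_le h2

theorem measure_one_lt_le (h : IsPoissonProcess P lam N) (hA : MeasurableSet A)
    (hA' : volume A ≠ ∞) : P {ω | 1 < N ω A} ≤ (lam * volume A) ^ 2 := by
  have h1 := h.measure_apply_mem hA hA' (measurableSet_Ioi (a := (1 : ℝ≥0∞)))
  have h2 := poissonMeasure_compl_zero_one_le (lam * (volume A).toNNReal)
  rw [ENNReal.coe_mul, ENNReal.coe_toNNReal hA'] at h2
  have h3 : {n : ℕ | (n : ℝ≥0∞) ∈ Set.Ioi (1 : ℝ≥0∞)} = ({0, 1} : Set ℕ)ᶜ := by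
    ext n
    simp only [Set.mem_Ioi, Set.mem_ofPred_eq, Nat.one_lt_cast, Set.mem_compl_iff,
      Set.mem_insert_iff, Set.mem_singleton_iff]
    omega
  rw [h3] at h1
  exact h1.trans_le h2

theorem measure_eq_natCast_pos (h : IsPoissonProcess P lam N) (hlam : 0 < lam)
    (hA : MeasurableSet A) (hA' : volume A ≠ ∞) (hA0 : volume A ≠ 0) (n : ℕ) :
    0 < P {ω | N ω A = n} := by
  have h1 := h.measure_apply_mem hA hA' (MeasurableSet.singleton (n : ℝ≥0∞))
  have h3 : {m : ℕ | (m : ℝ≥0∞) ∈ ({(n : ℝ≥0∞)} : Set ℝ≥0∞)} = {n} := by ext m; simp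
  have hr : 0 < lam * (volume A).toNNReal :=
    mul_pos hlam (ENNReal.toNNReal_pos hA0 hA')
  have h2 := poissonMeasure_real_singleton_pos n hr
  rw [h3] at h1
  simp only [Set.mem_singleton_iff] at h1
  rw [h1]
  exact (ENNReal.toReal_pos_iff.1 h2).1

theorem measure_eq_zero_eq (h : IsPoissonProcess P lam N) (hA : MeasurableSet A)
    (hA' : volume A ≠ ∞) (hB : MeasurableSet A') (hAB : volume A' = volume A) :
    P {ω | N ω A' = 0} = P {ω | N ω A = 0} := by
  have h1 := h.measure_apply_mem hA hA' (MeasurableSet.singleton (0 : ℝ≥0∞))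
  have h2 := h.measure_apply_mem hB (hAB ▸ hA') (MeasurableSet.singleton (0 : ℝ≥0∞))
  rw [hAB, ← h1] at h2
  exact h2

theorem measure_eq_zero_pos (h : IsPoissonProcess P lam N) (hA : MeasurableSet A)
    (hA' : volume A ≠ ∞) : 0 < P {ω | N ω A = 0} := by
  have h1 := h.measure_apply_mem hA hA' (MeasurableSet.singleton (0 : ℝ≥0∞))
  have h3 : {m : ℕ | (m : ℝ≥0∞) ∈ ({0} : Set ℝ≥0∞)} = {0} := by ext m; simp
  rw [h3, poissonMeasure_singleton] at h1
  simp only [Set.mem_singleton_iff] at h1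
  rw [h1, ENNReal.ofReal_pos]
  simp [Real.exp_pos]

theorem memLp_two_toReal (h : IsPoissonProcess P lam N) (hA : MeasurableSet A)
    (hA' : volume A ≠ ∞) : MemLp (fun ω => (N ω A).toReal) 2 P := by
  have h1 : MemLp (ENNReal.toReal) 2 (P.map fun ω => N ω A) := by
    rw [h.hasLaw A hA hA', memLp_map_measure_iff (by fun_prop) (by fun_prop)]
    convert! memLp_two_cast_poissonMeasure (lam * (volume A).toNNReal) using 1
  exact (memLp_map_measure_iff (by fun_prop) (h.measurable_apply hA).aemeasurable).1 h1

theorem identDistrib_toReal {N' : Ω → Measure ℝ} (h : IsPoissonProcess P lam N)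
    (h' : IsPoissonProcess P lam N') (hA : MeasurableSet A) (hA' : volume A ≠ ∞)
    (hB : MeasurableSet A') (hAB : volume A' = volume A) :
    IdentDistrib (fun ω => (N ω A).toReal) (fun ω => (N' ω A').toReal) P P := by
  have h1 : IdentDistrib (fun ω => N ω A) (fun ω => N' ω A') P P :=
    ⟨(h.measurable_apply hA).aemeasurable, (h'.measurable_apply hB).aemeasurable, by
      rw [h.hasLaw A hA hA', h'.hasLaw A' hB (hAB ▸ hA'), hAB]⟩
  exact h1.comp ENNReal.measurable_toReal

theorem variance_toReal_ne_zero [IsProbabilityMeasure P] (h : IsPoissonProcess P lam N)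
    (hlam : 0 < lam) (hA : MeasurableSet A) (hA' : volume A ≠ ∞) (hA0 : volume A ≠ 0) :
    Var[fun ω => (N ω A).toReal; P] ≠ 0 := by
  intro hv
  have hL := h.memLp_two_toReal hA hA'
  have h1 : evariance (fun ω => (N ω A).toReal) P = 0 := by
    rw [← hL.ofReal_variance_eq, hv, ENNReal.ofReal_zero]
  rw [evariance_eq_zero_iff hL.aemeasurable] at h1
  have key : ∀ n : ℕ, ∫ ω, (N ω A).toReal ∂P = (n : ℝ) := by
    intro n
    have h2 := h.measure_eq_natCast_pos hlam hA hA' hA0 n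
    obtain ⟨ω, hω, hω'⟩ := (((frequently_ae_iff).2 h2.ne').and_eventually h1).exists
    simp only [hω, ENNReal.toReal_natCast] at hω'
    exact hω'.symm
  have := (key 0).symm.trans (key 1)
  norm_num at this

end IsPoissonProcess

end Law

/-! ### Counting the atoms of a Poisson process -/

theorem ENNReal.eq_zero_of_le_div_natCast {x C : ℝ≥0∞} (hC : C ≠ ∞)
    (h : ∀ᶠ n : ℕ in Filter.atTop, x ≤ C / n) : x = 0 := by
  have h1 : Filter.Tendsto (fun n : ℕ => C / (n : ℝ≥0∞)) Filter.atTop (nhds 0) := by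
    simpa [div_eq_mul_inv] using
      ENNReal.Tendsto.const_mul ENNReal.tendsto_inv_nat_nhds_zero (Or.inr hC)
  exact nonpos_iff_eq_zero.1 (ge_of_tendsto h1 h)

/-- The mass of `N` on the interval `(a, b]` is the number of atoms of `N` there, and this number
is finite. -/
def CountsAtoms (N : Measure ℝ) (a b : ℝ) : Prop :=
  (pointSet N ∩ Set.Ioc a b).Finite ∧ N (Set.Ioc a b) = ((pointSet N ∩ Set.Ioc a b).ncard : ℕ)

theorem CountsAtoms.trans {N : Measure ℝ} {a b c : ℝ} (hab : a ≤ b) (hbc : b ≤ c)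
    (h : CountsAtoms N a b) (h' : CountsAtoms N b c) : CountsAtoms N a c := by
  have hd : Disjoint (Set.Ioc a b) (Set.Ioc b c) := Set.Ioc_disjoint_Ioc_of_le le_rfl
  unfold CountsAtoms
  rw [← Set.Ioc_union_Ioc_eq_Ioc hab hbc, measure_union hd measurableSet_Ioc,
    Set.inter_union_distrib_left,
    Set.ncard_union_eq (hd.mono Set.inter_subset_right Set.inter_subset_right) h.1 h'.1, h.2, h'.2]
  exact ⟨h.1.union h'.1, by push_cast; rfl⟩

theorem notMem_pointSet_of_null {N : Measure ℝ} {A : Set ℝ} (hA : N A = 0) {x : ℝ}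
    (hx : x ∈ A) : x ∉ pointSet N := fun h =>
  h.ne' (measure_mono_null (Set.singleton_subset_iff.2 hx) hA)

/-- An interval of mass at most one carries at most one atom, which accounts for all of its mass,
provided that `N` is integer valued on rational intervals: the atom is the infimum of the
`q` for which `(a, q]` has positive mass. -/
theorem countsAtoms_of_le_one {N : Measure ℝ} (hint : ∀ q r : ℚ, ∃ n : ℕ, N (Set.Ioc q r) = n)
    {a b : ℚ} (h1 : N (Set.Ioc a b) ≤ 1) : CountsAtoms N a b := by
  by_cases h0 : N (Set.Ioc (a : ℝ) b) = 0
  · have he : pointSet N ∩ Set.Ioc (a : ℝ) b = ∅ :=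
      Set.eq_empty_of_forall_notMem fun x hx => notMem_pointSet_of_null h0 hx.2 hx.1
    simp [CountsAtoms, he, h0]
  have ge_one : ∀ q r : ℚ, N (Set.Ioc (q : ℝ) r) ≠ 0 → 1 ≤ N (Set.Ioc (q : ℝ) r) := by
    intro q r h
    obtain ⟨n, hn⟩ := hint q r
    rw [hn] at h ⊢
    exact_mod_cast Nat.one_le_iff_ne_zero.2 (by exact_mod_cast h)
  have hab : a < b := by
    by_contra hab
    rw [Set.Ioc_eq_empty (by exact_mod_cast hab)] at h0
    simp at h0
  have hN1 : N (Set.Ioc (a : ℝ) b) = 1 := le_antisymm h1 (ge_one a b h0)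
  let S : Set ℝ := {y | ∃ q : ℚ, y = q ∧ a < q ∧ q ≤ b ∧ N (Set.Ioc (a : ℝ) q) ≠ 0}
  have hbS : (b : ℝ) ∈ S := ⟨b, rfl, hab, le_rfl, h0⟩
  have hbdd : BddBelow S := ⟨a, by rintro _ ⟨q, rfl, hq, -⟩; exact_mod_cast hq.le⟩
  let x := sInf S
  have hxb : x ≤ b := csInf_le hbdd hbS
  have hax : (a : ℝ) ≤ x :=
    le_csInf ⟨_, hbS⟩ (by rintro _ ⟨q, rfl, hq, -⟩; exact_mod_cast hq.le)
  have hleft : N (Set.Ioo (a : ℝ) x) = 0 := by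
    refine measure_mono_null (t := ⋃ q ∈ {q : ℚ | N (Set.Ioc (a : ℝ) q) = 0}, Set.Ioc (a : ℝ) q)
      (fun y hy => ?_) ((measure_biUnion_null_iff (Set.to_countable _)).2 fun q hq => hq)
    obtain ⟨q, hq1, hq2⟩ := exists_rat_btwn hy.2
    refine Set.mem_biUnion (x := q) ?_ ⟨hy.1, hq1.le⟩
    by_contra hq
    exact hq2.not_ge (csInf_le hbdd ⟨q, rfl, by exact_mod_cast hy.1.trans hq1,
      by exact_mod_cast (hq2.trans_le hxb).le, hq⟩)
  -- If `(q, b]` had positive mass for some `q` with `(a, q]` of positive mass, the total mass would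
  -- be at least two.
  have hright : N (Set.Ioc x b) = 0 := by
    refine measure_mono_null (t := ⋃ q ∈ {q : ℚ | N (Set.Ioc (q : ℝ) b) = 0}, Set.Ioc (q : ℝ) b)
      (fun y hy => ?_) ((measure_biUnion_null_iff (Set.to_countable _)).2 fun q hq => hq)
    obtain ⟨_, ⟨q, rfl, hq1, hq2, hq3⟩, hqy⟩ := exists_lt_of_csInf_lt ⟨_, hbS⟩ hy.1
    refine Set.mem_biUnion (x := q) ?_ ⟨hqy, hy.2⟩
    by_contra hq
    have h2 : N (Set.Ioc (a : ℝ) b) = N (Set.Ioc (a : ℝ) q) + N (Set.Ioc (q : ℝ) b) := by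
      rw [← measure_union (Set.Ioc_disjoint_Ioc_of_le le_rfl) measurableSet_Ioc,
        Set.Ioc_union_Ioc_eq_Ioc (by exact_mod_cast hq1.le) (by exact_mod_cast hq2)]
    have h3 := add_le_add (ge_one a q hq3) (ge_one q b hq)
    rw [← h2, hN1] at h3
    exact absurd h3 (by norm_num)
  have hax' : (a : ℝ) < x := by
    refine lt_of_le_of_ne hax fun h => h0 ?_
    rw [h]
    exact hright
  have hx : x ∈ pointSet N := by
    by_contra hx'
    have hx0 : N {x} = 0 := by simpa [pointSet] using hx'
    refine h0 ?_
    have hsub : Set.Ioc (a : ℝ) b ⊆ (Set.Ioo (a : ℝ) x ∪ {x}) ∪ Set.Ioc x b := by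
      intro y hy
      rcases lt_trichotomy y x with h | h | h
      · exact Or.inl (Or.inl ⟨hy.1, h⟩)
      · exact Or.inl (Or.inr h)
      · exact Or.inr ⟨h, hy.2⟩
    exact measure_mono_null hsub (measure_union_null (measure_union_null hleft hx0) hright)
  have hsing : pointSet N ∩ Set.Ioc (a : ℝ) b = {x} := by
    refine Set.eq_singleton_iff_unique_mem.2 ⟨⟨hx, hax', hxb⟩, fun y hy => ?_⟩
    rcases lt_trichotomy y x with h | h | h
    · exact absurd hy.1 (notMem_pointSet_of_null hleft ⟨hy.2.1, h⟩)
    · exact h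
    · exact absurd hy.1 (notMem_pointSet_of_null hright ⟨h, hy.2.2⟩)
  simp [CountsAtoms, hsing, hN1]

section Counting

variable {Ω : Type*} [MeasurableSpace Ω] {P : Measure Ω} {lam : ℝ≥0} {N : Ω → Measure ℝ}

namespace IsPoissonProcess

theorem ae_exists_nat_rat (h : IsPoissonProcess P lam N) :
    ∀ᵐ ω ∂P, ∀ q r : ℚ, ∃ n : ℕ, N ω (Set.Ioc q r) = n := by
  rw [ae_all_iff]
  intro q
  rw [ae_all_iff]
  intro r
  exact h.ae_exists_nat measurableSet_Ioc (by simp)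

/-- A unit interval can be cut into equal pieces each of which has mass at most one: the
probability that this fails for `n` pieces is of order `n * (1 / n) ^ 2`. -/
theorem ae_exists_subdivision (h : IsPoissonProcess P lam N) :
    ∀ᵐ ω ∂P, ∀ k : ℤ, ∃ n : ℕ, 0 < n ∧ ∀ i < n,
      N ω (Set.Ioc (k + i / n) (k + (i + 1) / n)) ≤ 1 := by
  rw [ae_all_iff]
  intro k
  rw [ae_iff]
  refine ENNReal.eq_zero_of_le_div_natCast (C := (lam : ℝ≥0∞) ^ 2) (by simp)
    ((Filter.eventually_gt_atTop 0).mono fun n hn => ?_)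
  have hn' : (n : ℝ) ≠ 0 := by positivity
  have hvol : ∀ i : ℕ, volume (Set.Ioc ((k : ℝ) + i / n) (k + (i + 1) / n)) = (n : ℝ≥0∞)⁻¹ := by
    intro i
    rw [Real.volume_Ioc, show (k : ℝ) + (i + 1) / n - (k + i / n) = (n : ℝ)⁻¹ by field_simp; ring,
      ENNReal.ofReal_inv_of_pos (by positivity), ENNReal.ofReal_natCast]
  have hfin : (n : ℝ≥0∞)⁻¹ ≠ ∞ := by simp [hn.ne']
  calc P {ω | ¬∃ n : ℕ, 0 < n ∧ ∀ i < n, N ω (Set.Ioc (k + i / n) (k + (i + 1) / n)) ≤ 1}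
      ≤ P (⋃ i ∈ Finset.range n,
          {ω | 1 < N ω (Set.Ioc ((k : ℝ) + i / n) (k + (i + 1) / n))}) := by
        refine measure_mono fun ω hω => ?_
        simp only [Set.mem_ofPred_eq, not_exists, not_and, not_forall, not_le] at hω
        obtain ⟨i, hi, hi'⟩ := hω n hn
        exact Set.mem_biUnion (Finset.mem_coe.2 (Finset.mem_range.2 hi)) hi'
    _ ≤ ∑ i ∈ Finset.range n, P {ω | 1 < N ω (Set.Ioc ((k : ℝ) + i / n) (k + (i + 1) / n))} :=
        measure_biUnion_finset_le _ _
    _ ≤ ∑ i ∈ Finset.range n, ((lam : ℝ≥0∞) * (n : ℝ≥0∞)⁻¹) ^ 2 := by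
        refine Finset.sum_le_sum fun i _ => ?_
        rw [← hvol i]
        exact h.measure_one_lt_le measurableSet_Ioc (by rw [hvol]; exact hfin)
    _ = (lam : ℝ≥0∞) ^ 2 / n := by
        rw [Finset.sum_const, Finset.card_range, nsmul_eq_mul, mul_pow, sq (n : ℝ≥0∞)⁻¹,
          div_eq_mul_inv, ← mul_assoc, ← mul_assoc, mul_comm (n : ℝ≥0∞), mul_assoc _ (n : ℝ≥0∞),
          ENNReal.mul_inv_cancel (by simp [hn.ne']) (by simp), mul_one]

theorem ae_countsAtoms (h : IsPoissonProcess P lam N) :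
    ∀ᵐ ω ∂P, ∀ k : ℤ, CountsAtoms (N ω) k (k + 1) := by
  filter_upwards [h.ae_exists_nat_rat, h.ae_exists_subdivision] with ω h1 h2 k
  obtain ⟨n, hn, h3⟩ := h2 k
  have hn' : (n : ℝ) ≠ 0 := by positivity
  have key : ∀ i ≤ n, CountsAtoms (N ω) k (k + i / n) := by
    intro i
    induction i with
    | zero => intro _; simp [CountsAtoms]
    | succ i ih =>
      intro hi
      have h4 : CountsAtoms (N ω) (((k : ℚ) + i / n : ℚ) : ℝ) (((k : ℚ) + (i + 1) / n : ℚ) : ℝ) :=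
        countsAtoms_of_le_one h1 (by push_cast; exact h3 i hi)
      push_cast at h4 ⊢
      refine (ih (by omega)).trans ?_ ?_ h4
      · have : (0 : ℝ) ≤ i / n := by positivity
        linarith
      · gcongr; linarith
  simpa [div_self hn'] using key n le_rfl

end IsPoissonProcess

theorem finite_pointSet_inter_Icc {N : Measure ℝ} (h : ∀ k : ℤ, CountsAtoms N k (k + 1))
    (a b : ℝ) : (pointSet N ∩ Set.Icc a b).Finite := by
  have h1 : (⋃ k ∈ Set.Icc (⌈a⌉ - 1) (⌈b⌉ - 1), pointSet N ∩ Set.Ioc (k : ℝ) (k + 1)).Finite :=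
    (Set.finite_Icc _ _).biUnion fun k _ => (h k).1
  refine h1.subset fun x hx => ?_
  refine Set.mem_biUnion (x := ⌈x⌉ - 1) ⟨?_, ?_⟩ ⟨hx.1, ?_, ?_⟩
  · have := Int.ceil_mono hx.2.1
    omega
  · have := Int.ceil_mono hx.2.2
    omega
  · push_cast
    linarith [Int.ceil_lt_add_one x]
  · push_cast
    linarith [Int.le_ceil x]

end Counting

/-! ### Independence over disjoint sets and between the two processes -/

section Independence

variable {Ω : Type*} [MeasurableSpace Ω] {P : Measure Ω} {lam : ℝ≥0} {N R B : Ω → Measure ℝ}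

theorem IsPoissonProcess.iIndepFun_apply {κ : Type*} (h : IsPoissonProcess P lam N)
    {A : κ → Set ℝ} (hA : ∀ i, MeasurableSet (A i)) (hd : Pairwise (Function.onFun Disjoint A)) :
    iIndepFun (fun i ω => N ω (A i)) P := by
  rw [iIndepFun_iff_finset]
  intro s
  have h1 := h.indep _ (fun i : Fin (Fintype.card s) => A ((Fintype.equivFin s).symm i))
    (fun i => hA _) (fun i j hij => hd (by simpa [Subtype.ext_iff] using hij))
  exact (iIndepFun_precomp_of_bijective (f := fun (i : s) ω => N ω (A i))
    (Fintype.equivFin s).symm.bijective).1 h1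

theorem ProbabilityTheory.IndepFun.iIndepFun_bool [IsProbabilityMeasure P] {β : Type*}
    [MeasurableSpace β] {f g : Ω → β} (h : IndepFun f g P) :
    iIndepFun (fun (b : Bool) ω => bif b then f ω else g ω) P := by
  rw [iIndepFun_iff_measure_inter_preimage_eq_mul]
  intro S t ht
  have hS : S = ∅ ∨ S = {true} ∨ S = {false} ∨ S = {true, false} := by
    clear ht; revert S; decide
  rcases hS with rfl | rfl | rfl | rfl
  · simp
  · simp
  · simp
  · rw [Finset.prod_pair (by simp), Finset.set_biInter_insert, Finset.set_biInter_singleton]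
    exact h.measure_inter_preimage_eq_mul _ _ (ht true (by simp)) (ht false (by simp))

theorem iIndepFun_apply_pair [IsProbabilityMeasure P] {κ : Type*}
    (hR : IsPoissonProcess P lam R) (hB : IsPoissonProcess P lam B) (hRB : IndepFun R B P)
    {A : κ → Set ℝ} (hA : ∀ i, MeasurableSet (A i)) (hd : Pairwise (Function.onFun Disjoint A)) :
    iIndepFun (fun (p : Bool × κ) ω => (bif p.1 then R ω else B ω) (A p.2)) P := by
  refine iIndepFun_uncurry' (X := fun (b : Bool) (i : κ) ω => (bif b then R ω else B ω) (A i))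
    ?_ ?_ ?_
  · rintro (_ | _) i
    exacts [hB.measurable_apply (hA i), hR.measurable_apply (hA i)]
  · exact hRB.iIndepFun_bool.comp (fun _ N i => N (A i))
      fun _ => measurable_pi_lambda _ fun i => Measure.measurable_coe (hA i)
  · rintro (_ | _)
    exacts [hB.iIndepFun_apply hA hd, hR.iIndepFun_apply hA hd]

/-! ### Large empty intervals -/

/-- Among infinitely many disjoint sets of equal length, infinitely many contain no point of
either process, by the second Borel–Cantelli lemma. -/
theorem ae_frequently_empty [IsProbabilityMeasure P]
    (hR : IsPoissonProcess P lam R) (hB : IsPoissonProcess P lam B) (hRB : IndepFun R B P)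
    {A : ℕ → Set ℝ} (hA : ∀ i, MeasurableSet (A i)) (hd : Pairwise (Function.onFun Disjoint A))
    (hfin : volume (A 0) ≠ ∞) (hvol : ∀ i, volume (A i) = volume (A 0)) :
    ∀ᵐ ω ∂P, ∀ n : ℕ, ∃ j ≥ n, R ω (A j) = 0 ∧ B ω (A j) = 0 := by
  have hind := (iIndepFun_iff_measure_inter_preimage_eq_mul).1
    (iIndepFun_apply_pair hR hB hRB hA hd)
  let E : ℕ → Set Ω := fun j => {ω | R ω (A j) = 0} ∩ {ω | B ω (A j) = 0}
  have mE : ∀ j, MeasurableSet (E j) := fun j =>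
    ((hR.measurable_apply (hA j)) (MeasurableSet.singleton 0)).inter
      ((hB.measurable_apply (hA j)) (MeasurableSet.singleton 0))
  have hprod : ∀ s : Finset ℕ, P (⋂ j ∈ s, E j) =
      ∏ j ∈ s, P {ω | R ω (A j) = 0} * P {ω | B ω (A j) = 0} := by
    intro s
    have h1 := hind (Finset.univ ×ˢ s) (sets := fun _ => {0})
      fun _ _ => MeasurableSet.singleton 0
    rw [Finset.prod_product_right] at h1
    simp only [Fintype.prod_bool, cond_true, cond_false] at h1
    refine Eq.trans (congrArg P ?_) h1
    ext ω
    simp only [E, Set.mem_iInter, Set.mem_inter_iff, Set.mem_ofPred_eq, Finset.mem_product,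
      Finset.mem_univ, true_and, Prod.forall, Bool.forall_bool, Set.mem_preimage,
      Set.mem_singleton_iff, cond_true, cond_false]
    exact ⟨fun h => ⟨fun j hj => (h j hj).2, fun j hj => (h j hj).1⟩,
      fun h j hj => ⟨h.2 j hj, h.1 j hj⟩⟩
  have hone : ∀ j, P (E j) = P {ω | R ω (A j) = 0} * P {ω | B ω (A j) = 0} := fun j => by
    simpa using hprod {j}
  have hsum : ∑' j, P (E j) = ∞ := by
    have hconst : ∀ j, P (E j) = P {ω | R ω (A 0) = 0} * P {ω | B ω (A 0) = 0} := fun j => by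
      rw [hone, hR.measure_eq_zero_eq (hA 0) hfin (hA j) (hvol j),
        hB.measure_eq_zero_eq (hA 0) hfin (hA j) (hvol j)]
    simp_rw [hconst]
    refine ENNReal.tsum_const_eq_top_of_ne_zero (mul_ne_zero ?_ ?_)
    · exact (hR.measure_eq_zero_pos (hA 0) hfin).ne'
    · exact (hB.measure_eq_zero_pos (hA 0) hfin).ne'
  have hlim := measure_limsup_eq_one mE
    ((iIndepSet_iff_meas_biInter mE).2 fun s => by rw [hprod s]; simp_rw [hone]) hsum
  have hmem := (mem_ae_iff_prob_eq_one (MeasurableSet.measurableSet_limsup mE)).2 hlim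
  filter_upwards [hmem] with ω hω n
  rw [Filter.mem_limsup_iff_frequently_mem, Filter.frequently_atTop] at hω
  obtain ⟨j, hj, hj'⟩ := hω n
  exact ⟨j, hj, hj'⟩

theorem ae_gap_right [IsProbabilityMeasure P]
    (hR : IsPoissonProcess P lam R) (hB : IsPoissonProcess P lam B) (hRB : IndepFun R B P) :
    ∀ᵐ ω ∂P, ∀ a l : ℝ, ∃ b ≥ a, ∀ p, p ∈ pointSet (R ω) ∨ p ∈ pointSet (B ω) →
      b < p → b + l < p := by
  have h1 : ∀ᵐ ω ∂P, ∀ l : ℕ, ∀ n : ℕ, ∃ j ≥ n,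
      R ω (Set.Ioc ((j : ℝ) * (l + 1)) ((j + 1) * (l + 1))) = 0 ∧
      B ω (Set.Ioc ((j : ℝ) * (l + 1)) ((j + 1) * (l + 1))) = 0 := by
    rw [ae_all_iff]
    intro l
    have hvol : ∀ j : ℕ, volume (Set.Ioc ((j : ℝ) * (l + 1)) ((j + 1) * (l + 1))) =
        ENNReal.ofReal (l + 1) := fun j => by
      rw [Real.volume_Ioc]; congr 1; ring
    refine ae_frequently_empty hR hB hRB
      (A := fun j : ℕ => Set.Ioc ((j : ℝ) * (l + 1)) ((j + 1) * (l + 1)))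
      (fun _ => measurableSet_Ioc) ?_ (by rw [hvol]; simp) fun j => (hvol j).trans (hvol 0).symm
    refine (pairwise_disjoint_on _).2 fun i j hij => Set.Ioc_disjoint_Ioc_of_le ?_
    have : (i : ℝ) + 1 ≤ j := by exact_mod_cast hij
    gcongr
  filter_upwards [h1] with ω hω a l
  obtain ⟨j, hj, hjR, hjB⟩ := hω ⌈l⌉₊ ⌈a⌉₊
  have hl := Nat.le_ceil l
  refine ⟨(j : ℝ) * (⌈l⌉₊ + 1), ?_, fun p hp hjp => ?_⟩
  · have h2 : (⌈a⌉₊ : ℝ) ≤ j := by exact_mod_cast hj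
    have h3 := Nat.le_ceil a
    nlinarith [Nat.cast_nonneg (α := ℝ) ⌈l⌉₊, Nat.cast_nonneg (α := ℝ) j]
  · by_contra hp'
    have hmem : p ∈ Set.Ioc ((j : ℝ) * (⌈l⌉₊ + 1)) ((j + 1) * (⌈l⌉₊ + 1)) :=
      ⟨hjp, by linarith⟩
    exact hp.elim (notMem_pointSet_of_null hjR hmem) (notMem_pointSet_of_null hjB hmem)

theorem ae_gap_left [IsProbabilityMeasure P]
    (hR : IsPoissonProcess P lam R) (hB : IsPoissonProcess P lam B) (hRB : IndepFun R B P) :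
    ∀ᵐ ω ∂P, ∀ a l : ℝ, ∃ b ≤ a, ∀ p, p ∈ pointSet (R ω) ∨ p ∈ pointSet (B ω) →
      p ≤ b → p ≤ b - l := by
  have h1 : ∀ᵐ ω ∂P, ∀ l : ℕ, ∀ n : ℕ, ∃ j ≥ n,
      R ω (Set.Ioc (-((j : ℝ) + 1) * (l + 1)) (-j * (l + 1))) = 0 ∧
      B ω (Set.Ioc (-((j : ℝ) + 1) * (l + 1)) (-j * (l + 1))) = 0 := by
    rw [ae_all_iff]
    intro l
    have hvol : ∀ j : ℕ, volume (Set.Ioc (-((j : ℝ) + 1) * (l + 1)) (-j * (l + 1))) =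
        ENNReal.ofReal (l + 1) := fun j => by
      rw [Real.volume_Ioc]; congr 1; ring
    refine ae_frequently_empty hR hB hRB
      (A := fun j : ℕ => Set.Ioc (-((j : ℝ) + 1) * (l + 1)) (-j * (l + 1)))
      (fun _ => measurableSet_Ioc) ?_ (by rw [hvol]; simp) fun j => (hvol j).trans (hvol 0).symm
    refine (pairwise_disjoint_on _).2 fun i j hij =>
      (Set.Ioc_disjoint_Ioc_of_le ?_).symm
    have : (i : ℝ) + 1 ≤ j := by exact_mod_cast hij
    gcongr
  filter_upwards [h1] with ω hω a l
  obtain ⟨j, hj, hjR, hjB⟩ := hω ⌈l⌉₊ ⌈-a⌉₊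
  have hl := Nat.le_ceil l
  refine ⟨-(j : ℝ) * (⌈l⌉₊ + 1), ?_, fun p hp hjp => ?_⟩
  · have h2 : (⌈-a⌉₊ : ℝ) ≤ j := by exact_mod_cast hj
    have h3 := Nat.le_ceil (-a)
    nlinarith [Nat.cast_nonneg (α := ℝ) ⌈l⌉₊, Nat.cast_nonneg (α := ℝ) j]
  · by_contra hp'
    have hmem : p ∈ Set.Ioc (-((j : ℝ) + 1) * (⌈l⌉₊ + 1)) (-j * (⌈l⌉₊ + 1)) :=
      ⟨by linarith, hjp⟩
    exact hp.elim (notMem_pointSet_of_null hjR hmem) (notMem_pointSet_of_null hjB hmem)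

end Independence

/-! ### Absence of common points and of ties -/

/-- The cells `((i - 1) / k, i / k]` of the mesh of width `1 / k`. -/
def meshCell (k : ℕ) (i : ℤ) : Set ℝ := Set.Ioc (((i : ℝ) - 1) / k) (i / k)

theorem measurableSet_meshCell (k : ℕ) (i : ℤ) : MeasurableSet (meshCell k i) :=
  measurableSet_Ioc

theorem volume_meshCell {k : ℕ} (hk : 0 < k) (i : ℤ) :
    volume (meshCell k i) = (k : ℝ≥0∞)⁻¹ := by
  have hk' : (0 : ℝ) < k := by exact_mod_cast hk
  rw [meshCell, Real.volume_Ioc, show (i : ℝ) / k - (i - 1) / k = (k : ℝ)⁻¹ by field_simp; ring,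
    ENNReal.ofReal_inv_of_pos hk', ENNReal.ofReal_natCast]

theorem disjoint_meshCell (k : ℕ) {i j : ℤ} (hij : i < j) :
    Disjoint (meshCell k i) (meshCell k j) := by
  refine Set.Ioc_disjoint_Ioc_of_le ?_
  have : (i : ℝ) + 1 ≤ j := by exact_mod_cast hij
  gcongr
  linarith

theorem mem_meshCell_ceil {k : ℕ} (hk : 0 < k) (x : ℝ) : x ∈ meshCell k ⌈(k : ℝ) * x⌉ := by
  have hk' : (0 : ℝ) < k := by exact_mod_cast hk
  constructor
  · rw [div_lt_iff₀ hk']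
    linarith [Int.ceil_lt_add_one ((k : ℝ) * x)]
  · rw [le_div_iff₀ hk']
    linarith [Int.le_ceil ((k : ℝ) * x)]

theorem ceil_mul_mem_Icc {k n : ℕ} {x : ℝ} (hx : |x| ≤ n) :
    ⌈(k : ℝ) * x⌉ ∈ Finset.Icc (-((k * n : ℕ) : ℤ)) ((k * n : ℕ) : ℤ) := by
  obtain ⟨h1, h2⟩ := abs_le.1 hx
  have hk : (0 : ℝ) ≤ k := k.cast_nonneg
  rw [Finset.mem_Icc, Int.ceil_le]
  constructor
  · rw [Int.le_ceil_iff]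
    push_cast
    nlinarith
  · push_cast
    gcongr

theorem card_Icc_neg_le {m : ℕ} (hm : 0 < m) :
    ((Finset.Icc (-(m : ℤ)) m).card : ℝ≥0∞) ≤ 3 * m := by
  have h : (Finset.Icc (-(m : ℤ)) m).card ≤ 3 * m := by
    rw [Int.card_Icc]
    omega
  exact_mod_cast h

section Ties

variable {Ω : Type*} [MeasurableSpace Ω] {P : Measure Ω} {lam : ℝ≥0} {N R B : Ω → Measure ℝ}

theorem IsPoissonProcess.measure_meshCell_ne_zero_le (h : IsPoissonProcess P lam N) {k : ℕ}
    (hk : 0 < k) (i : ℤ) : P {ω | N ω (meshCell k i) ≠ 0} ≤ lam * (k : ℝ≥0∞)⁻¹ := by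
  rw [← volume_meshCell hk i]
  exact h.measure_ne_zero_le (measurableSet_meshCell k i)
    (by rw [volume_meshCell hk]; simp [hk.ne'])

/-- Two independent processes have no common point: both meet a given cell of the mesh of width
`1 / k` with probability of order `1 / k ^ 2`, and a bounded interval has of order `k` cells. -/
theorem ae_disjoint_pointSet (hR : IsPoissonProcess P lam R) (hB : IsPoissonProcess P lam B)
    (hRB : IndepFun R B P) : ∀ᵐ ω ∂P, Disjoint (pointSet (R ω)) (pointSet (B ω)) := by
  have h1 : ∀ᵐ ω ∂P, ∀ n : ℕ, ∀ x : ℝ, x ∈ pointSet (R ω) → x ∈ pointSet (B ω) → (n : ℝ) < |x| := by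
    rw [ae_all_iff]
    intro n
    rw [ae_iff]
    refine ENNReal.eq_zero_of_le_div_natCast (C := 3 * (n + 1 : ℕ) * (lam : ℝ≥0∞) ^ 2)
      (by finiteness) ((Filter.eventually_gt_atTop 0).mono fun k hk => ?_)
    let I := Finset.Icc (-((k * (n + 1) : ℕ) : ℤ)) ((k * (n + 1) : ℕ) : ℤ)
    calc _ ≤ P (⋃ i ∈ I, {ω | R ω (meshCell k i) ≠ 0} ∩ {ω | B ω (meshCell k i) ≠ 0}) := by
          refine measure_mono fun ω hω => ?_
          simp only [Set.mem_ofPred_eq, not_forall, not_lt] at hω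
          obtain ⟨x, hxR, hxB, hx⟩ := hω
          refine Set.mem_biUnion (x := ⌈(k : ℝ) * x⌉)
            (ceil_mul_mem_Icc (hx.trans (by push_cast; linarith))) ⟨fun h => ?_, fun h => ?_⟩
          · exact notMem_pointSet_of_null h (mem_meshCell_ceil hk x) hxR
          · exact notMem_pointSet_of_null h (mem_meshCell_ceil hk x) hxB
      _ ≤ ∑ i ∈ I, P ({ω | R ω (meshCell k i) ≠ 0} ∩ {ω | B ω (meshCell k i) ≠ 0}) :=
          measure_biUnion_finset_le _ _
      _ ≤ ∑ i ∈ I, ((lam : ℝ≥0∞) * (k : ℝ≥0∞)⁻¹) * (lam * (k : ℝ≥0∞)⁻¹) := by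
          refine Finset.sum_le_sum fun i _ => ?_
          have h2 := (hRB.comp (Measure.measurable_coe (measurableSet_meshCell k i))
            (Measure.measurable_coe (measurableSet_meshCell k i))).measure_inter_preimage_eq_mul
            {0}ᶜ {0}ᶜ (MeasurableSet.singleton 0).compl (MeasurableSet.singleton 0).compl
          exact h2.trans_le (mul_le_mul' (hR.measure_meshCell_ne_zero_le hk i)
            (hB.measure_meshCell_ne_zero_le hk i))
      _ ≤ (3 * (k * (n + 1) : ℕ)) * ((lam * (k : ℝ≥0∞)⁻¹) * (lam * (k : ℝ≥0∞)⁻¹)) := by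
          rw [Finset.sum_const, nsmul_eq_mul]
          gcongr
          exact card_Icc_neg_le (by positivity)
      _ = (3 * (n + 1 : ℕ) * (lam : ℝ≥0∞) ^ 2 * (k : ℝ≥0∞)⁻¹) * (k * (k : ℝ≥0∞)⁻¹) := by
          push_cast; ring
      _ = _ := by
          rw [ENNReal.mul_inv_cancel (by simp [hk.ne']) (by simp), mul_one, div_eq_mul_inv]
  filter_upwards [h1] with ω hω
  refine Set.disjoint_left.2 fun x hxR hxB => ?_
  obtain ⟨n, hn⟩ := exists_nat_ge |x|
  exact (hω n x hxR hxB).not_ge hn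

/-- The midpoint of two points in different cells lies in one of two cells determined by the
cells of these points. -/
theorem ceil_mul_midpoint (k : ℕ) (y z : ℝ) :
    ⌈(k : ℝ) * ((y + z) / 2)⌉ - (⌈(k : ℝ) * y⌉ + ⌈(k : ℝ) * z⌉) / 2 ∈ ({0, 1} : Finset ℤ) := by
  set s := ⌈(k : ℝ) * y⌉ + ⌈(k : ℝ) * z⌉ with hs
  have hs' : (s : ℝ) = (⌈(k : ℝ) * y⌉ : ℝ) + ⌈(k : ℝ) * z⌉ := by rw [hs]; push_cast; rfl
  have hy1 := Int.le_ceil ((k : ℝ) * y)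
  have hy2 := Int.ceil_lt_add_one ((k : ℝ) * y)
  have hz1 := Int.le_ceil ((k : ℝ) * z)
  have hz2 := Int.ceil_lt_add_one ((k : ℝ) * z)
  have h1 : ⌈(k : ℝ) * ((y + z) / 2)⌉ ≤ s / 2 + 1 := by
    rw [Int.ceil_le]
    have : (s : ℝ) ≤ 2 * ((s / 2 : ℤ) : ℝ) + 1 := by
      exact_mod_cast (show s ≤ 2 * (s / 2) + 1 by omega)
    push_cast
    linarith
  have h2 : s / 2 - 1 < ⌈(k : ℝ) * ((y + z) / 2)⌉ := by
    rw [Int.lt_ceil]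
    have : 2 * ((s / 2 : ℤ) : ℝ) ≤ s := by
      exact_mod_cast (show 2 * (s / 2) ≤ s by omega)
    push_cast
    linarith
  simp only [Finset.mem_insert, Finset.mem_singleton]
  omega

/-- No point of `R` is the midpoint of two points of `B`: for a mesh of width `1 / k`, a bounded
interval has of order `k ^ 2` triples of cells that such points could occupy, and each triple is
occupied with probability of order `1 / k ^ 3`. -/
theorem ae_not_midpoint (hR : IsPoissonProcess P lam R) (hB : IsPoissonProcess P lam B)
    (hRB : IndepFun R B P) : ∀ᵐ ω ∂P, ∀ x ∈ pointSet (R ω), ∀ y ∈ pointSet (B ω),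
      ∀ z ∈ pointSet (B ω), y < z → x ≠ (y + z) / 2 := by
  have h1 : ∀ᵐ ω ∂P, ∀ n : ℕ, ∀ y ∈ pointSet (B ω), ∀ z ∈ pointSet (B ω), |y| ≤ n → |z| ≤ n →
      1 ≤ n * (z - y) → (y + z) / 2 ∉ pointSet (R ω) := by
    rw [ae_all_iff]
    intro n
    rw [ae_iff]
    refine ENNReal.eq_zero_of_le_div_natCast (C := 18 * (n : ℝ≥0∞) ^ 2 * (lam : ℝ≥0∞) ^ 3)
      (by finiteness) ((Filter.eventually_ge_atTop (n + 1)).mono fun k hkn => ?_)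
    have hk : 0 < k := by omega
    -- for `n = 0` the event is empty
    rcases Nat.eq_zero_or_pos n with rfl | hn
    · refine le_of_eq_of_le ?_ zero_le
      convert! measure_empty (μ := P)
      ext ω
      norm_num
    let I := Finset.Icc (-((k * n : ℕ) : ℤ)) ((k * n : ℕ) : ℤ)
    let E : ℤ × ℤ × ℤ → Set Ω := fun p => {ω | R ω (meshCell k ((p.1 + p.2.1) / 2 + p.2.2)) ≠ 0} ∩
      ({ω | B ω (meshCell k p.1) ≠ 0} ∩ {ω | B ω (meshCell k p.2.1) ≠ 0})
    have hE : ∀ p : ℤ × ℤ × ℤ, p.1 < p.2.1 → P (E p) ≤ ((lam : ℝ≥0∞) * (k : ℝ≥0∞)⁻¹) ^ 3 := by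
      intro p hp
      have h2 := hRB.measure_inter_preimage_eq_mul
        {N | N (meshCell k ((p.1 + p.2.1) / 2 + p.2.2)) ≠ 0}
        ({N | N (meshCell k p.1) ≠ 0} ∩ {N | N (meshCell k p.2.1) ≠ 0})
        (Measure.measurable_coe (measurableSet_meshCell _ _) (MeasurableSet.singleton 0).compl)
        ((Measure.measurable_coe (measurableSet_meshCell _ _)
          (MeasurableSet.singleton 0).compl).inter
          (Measure.measurable_coe (measurableSet_meshCell _ _) (MeasurableSet.singleton 0).compl))
      have hd : Pairwise (Function.onFun Disjoint
          fun b : Bool => meshCell k (bif b then p.2.1 else p.1)) := by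
        rintro (_ | _) (_ | _) hne
        · exact absurd rfl hne
        · exact disjoint_meshCell k hp
        · exact (disjoint_meshCell k hp).symm
        · exact absurd rfl hne
      have h3 := ((hB.iIndepFun_apply (fun b => measurableSet_meshCell k _) hd).indepFun
        (show false ≠ true by simp)).measure_inter_preimage_eq_mul {0}ᶜ {0}ᶜ
        (MeasurableSet.singleton 0).compl (MeasurableSet.singleton 0).compl
      calc P (E p) = _ := h2
        _ ≤ (lam * (k : ℝ≥0∞)⁻¹) * ((lam * (k : ℝ≥0∞)⁻¹) * (lam * (k : ℝ≥0∞)⁻¹)) :=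
            mul_le_mul' (hR.measure_meshCell_ne_zero_le hk _)
              (h3.trans_le (mul_le_mul' (hB.measure_meshCell_ne_zero_le hk _)
                (hB.measure_meshCell_ne_zero_le hk _)))
        _ = _ := by ring
    let J := (I ×ˢ I ×ˢ ({0, 1} : Finset ℤ)).filter fun p => p.1 < p.2.1
    calc _ ≤ P (⋃ p ∈ J, E p) := by
          refine measure_mono fun ω hω => ?_
          simp only [Set.mem_ofPred_eq, not_forall, not_not] at hω
          obtain ⟨y, hy, z, hz, hyn, hzn, hyz, hx⟩ := hω
          -- the mesh is finer than the distance of `y` and `z`, so these lie in different cells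
          have hlt : ⌈(k : ℝ) * y⌉ < ⌈(k : ℝ) * z⌉ := by
            rw [Int.lt_ceil]
            have h4 : (n : ℝ) + 1 ≤ k := by exact_mod_cast hkn
            have h5 : 0 < z - y := by
              by_contra h5
              nlinarith [n.cast_nonneg (α := ℝ)]
            nlinarith [Int.ceil_lt_add_one ((k : ℝ) * y)]
          refine Set.mem_biUnion (x := (⌈(k : ℝ) * y⌉, ⌈(k : ℝ) * z⌉,
            ⌈(k : ℝ) * ((y + z) / 2)⌉ - (⌈(k : ℝ) * y⌉ + ⌈(k : ℝ) * z⌉) / 2)) ?_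
            ⟨fun h => ?_, fun h => ?_, fun h => ?_⟩
          · simp only [J, Finset.coe_filter, Finset.mem_product, Set.mem_ofPred_eq]
            exact ⟨⟨ceil_mul_mem_Icc hyn, ceil_mul_mem_Icc hzn, ceil_mul_midpoint k y z⟩, hlt⟩
          · simp only [add_sub_cancel] at h
            exact notMem_pointSet_of_null h (mem_meshCell_ceil hk _) hx
          · exact notMem_pointSet_of_null h (mem_meshCell_ceil hk _) hy
          · exact notMem_pointSet_of_null h (mem_meshCell_ceil hk _) hz
      _ ≤ ∑ p ∈ J, P (E p) := measure_biUnion_finset_le _ _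
      _ ≤ ∑ p ∈ J, ((lam : ℝ≥0∞) * (k : ℝ≥0∞)⁻¹) ^ 3 :=
          Finset.sum_le_sum fun p hp => hE p (Finset.mem_filter.1 hp).2
      _ ≤ (3 * (k * n : ℕ) * (3 * (k * n : ℕ) * 2)) * ((lam : ℝ≥0∞) * (k : ℝ≥0∞)⁻¹) ^ 3 := by
          rw [Finset.sum_const, nsmul_eq_mul]
          gcongr
          have h6 := card_Icc_neg_le (m := k * n) (by positivity)
          calc (J.card : ℝ≥0∞) ≤ ((I ×ˢ I ×ˢ ({0, 1} : Finset ℤ)).card : ℕ) := by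
                exact_mod_cast Finset.card_filter_le _ _
            _ = (I.card : ℝ≥0∞) * (I.card * 2) := by
                rw [Finset.card_product, Finset.card_product]
                simp
            _ ≤ _ := by gcongr
      _ = (18 * (n : ℝ≥0∞) ^ 2 * (lam : ℝ≥0∞) ^ 3 * (k : ℝ≥0∞)⁻¹) * (k * (k : ℝ≥0∞)⁻¹) *
            (k * (k : ℝ≥0∞)⁻¹) := by
          push_cast; ring
      _ = _ := by
          rw [ENNReal.mul_inv_cancel (by simp [hk.ne']) (by simp), mul_one, mul_one,
            div_eq_mul_inv]
  filter_upwards [h1] with ω hω x hx y hy z hz hyz hxyz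
  have h2 : 0 < z - y := sub_pos.2 hyz
  obtain ⟨n, hn⟩ := exists_nat_ge (max (max |y| |z|) (1 / (z - y)))
  refine hω n y hy z hz (((le_max_left _ _).trans (le_max_left _ _)).trans hn)
    (((le_max_right _ _).trans (le_max_left _ _)).trans hn) ?_ (hxyz ▸ hx)
  rw [← div_le_iff₀ h2]
  exact (le_max_right _ _).trans hn

theorem ae_no_tie (hR : IsPoissonProcess P lam R) (hB : IsPoissonProcess P lam B)
    (hRB : IndepFun R B P) : ∀ᵐ ω ∂P, ∀ x ∈ pointSet (R ω), ∀ y ∈ pointSet (B ω),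
      ∀ z ∈ pointSet (B ω), |x - y| = |x - z| → y = z := by
  filter_upwards [ae_not_midpoint hR hB hRB] with ω hω x hx y hy z hz h
  rcases abs_eq_abs.1 h with h1 | h1
  · linarith
  · rcases lt_trichotomy y z with h2 | h2 | h2
    · exact absurd (by linarith) (hω x hx y hy z hz h2)
    · exact h2
    · exact absurd (by linarith) (hω x hx z hz y hy h2)

end Ties

/-! ### Excursions of the walk of a pair of Poisson processes -/

section UnitCells

variable {S : Set ℝ}

/-- The number of points of `S` in the unit cell `(k, k + 1]`. -/
noncomputable def cellCount (S : Set ℝ) (k : ℤ) : ℕ := (S ∩ Set.Ioc (k : ℝ) (k + 1)).ncard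

theorem ncard_inter_Ioc_zero_natCast (hS : ∀ a b, (S ∩ Set.Icc a b).Finite) (n : ℕ) :
    (S ∩ Set.Ioc (0 : ℝ) n).ncard = ∑ k ∈ Finset.range n, cellCount S k := by
  induction n with
  | zero => simp
  | succ n ih =>
    rw [Finset.sum_range_succ, ← ih, Nat.cast_add, Nat.cast_one,
      ← ncard_inter_Ioc_add hS (t := (n : ℝ)) (by positivity) (by simp)]
    simp [cellCount]

theorem ncard_inter_Ioc_neg_natCast_zero (hS : ∀ a b, (S ∩ Set.Icc a b).Finite) (n : ℕ) :
    (S ∩ Set.Ioc (-n : ℝ) 0).ncard = ∑ k ∈ Finset.range n, cellCount S (-k - 1) := by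
  induction n with
  | zero => simp
  | succ n ih =>
    rw [Finset.sum_range_succ, ← ih,
      ← ncard_inter_Ioc_add hS (t := (-n : ℝ)) (by push_cast; linarith) (by simp), add_comm]
    congr 2
    push_cast
    congr 2 <;> ring

theorem ncard_inter_Ioc_mono (hS : ∀ a b, (S ∩ Set.Icc a b).Finite) {a b c d : ℝ} (hca : c ≤ a)
    (hbd : b ≤ d) : (S ∩ Set.Ioc a b).ncard ≤ (S ∩ Set.Ioc c d).ncard :=
  Set.ncard_le_ncard (Set.inter_subset_inter_right _ (Set.Ioc_subset_Ioc hca hbd))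
    (finite_inter_Ioc hS _ _)

end UnitCells

/-- Lower bounds for the walk at integer distances from the origin, allowing for the down-steps in
one more cell, give a lower bound in between. -/
theorem le_walk_of_le_sum_cellCount {R B : Set ℝ} (hR : ∀ a b, (R ∩ Set.Icc a b).Finite)
    (hB : ∀ a b, (B ∩ Set.Icc a b).Finite) {M : ℤ} {t : ℝ}
    (hr : M + (∑ k ∈ Finset.range (⌊|t|⌋₊ + 1), cellCount B k : ℕ) ≤
      (∑ k ∈ Finset.range ⌊|t|⌋₊, cellCount R k : ℕ))
    (hl : M + (∑ k ∈ Finset.range (⌊|t|⌋₊ + 1), cellCount R (-k - 1) : ℕ) ≤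
      (∑ k ∈ Finset.range ⌊|t|⌋₊, cellCount B (-k - 1) : ℕ)) : M ≤ walk R B t := by
  have h1 := Nat.floor_le (abs_nonneg t)
  have h2 := (Nat.lt_floor_add_one |t|).le
  rcases le_total 0 t with ht | ht
  · rw [← ncard_inter_Ioc_zero_natCast hB, ← ncard_inter_Ioc_zero_natCast hR] at hr
    rw [abs_of_nonneg ht] at *
    have h3 := ncard_inter_Ioc_mono hR (le_refl (0 : ℝ)) h1
    have h4 := ncard_inter_Ioc_mono hB (le_refl (0 : ℝ)) h2
    push_cast at hr
    simp only [walk, excess, Set.Ioc_eq_empty ht.not_gt, Set.inter_empty, Set.ncard_empty]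
    omega
  · rw [← ncard_inter_Ioc_neg_natCast_zero hB, ← ncard_inter_Ioc_neg_natCast_zero hR] at hl
    rw [abs_of_nonpos ht] at *
    have h3 := ncard_inter_Ioc_mono hB (by linarith : t ≤ -(⌊-t⌋₊ : ℝ)) (le_refl (0 : ℝ))
    have h4 := ncard_inter_Ioc_mono hR (by linarith : -((⌊-t⌋₊ : ℝ) + 1) ≤ t) (le_refl (0 : ℝ))
    push_cast at hl
    simp only [walk, excess, Set.Ioc_eq_empty ht.not_gt, Set.inter_empty, Set.ncard_empty]
    omega

/-- Enumeration of the unit cells, once for each process (`true` stands for red): the even terms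
run through the cells to the right of the origin, with blue and red alternating, and the odd terms
through the cells to the left, with red and blue alternating. -/
def cellIndex (n : ℕ) : Bool × ℤ :=
  if n % 4 = 0 then (false, (n / 4 : ℕ)) else if n % 4 = 1 then (true, -(n / 4 : ℕ) - 1)
  else if n % 4 = 2 then (true, (n / 4 : ℕ)) else (false, -(n / 4 : ℕ) - 1)

theorem cellIndex_injective : Function.Injective cellIndex := by
  intro m n h
  unfold cellIndex at h
  split_ifs at h <;> simp only [Prod.mk.injEq, reduceCtorEq, false_and, true_and] at h <;> omega

section Walk

variable {Ω : Type*} [MeasurableSpace Ω] {P : Measure Ω} [IsProbabilityMeasure P] {lam : ℝ≥0}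
  {R B : Ω → Measure ℝ}

/-- The walk is almost surely above any given level at all distances from `L` to `4 * L` from the
origin, on both sides, for arbitrarily large `L`: its two sides are alternating sums over the even
and the odd terms of the enumeration `cellIndex` of the numbers of points in unit cells. -/
theorem ae_exists_walk_ge (hlam : 0 < lam) (hR : IsPoissonProcess P lam R)
    (hB : IsPoissonProcess P lam B) (hRB : IndepFun R B P) :
    ∀ᵐ ω ∂P, ∀ M : ℤ, ∀ K : ℝ, ∃ L ≥ K, ∀ t, L ≤ |t| → |t| ≤ 4 * L →
      M ≤ walk (pointSet (R ω)) (pointSet (B ω)) t := by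
  let cell : ℤ → Set ℝ := fun k => Set.Ioc (k : ℝ) (k + 1)
  have mcell : ∀ k, MeasurableSet (cell k) := fun k => measurableSet_Ioc
  have vcell : ∀ k, volume (cell k) = 1 := fun k => by simp [cell]
  have hd : Pairwise (Function.onFun Disjoint cell) := by
    intro i j hij
    rcases lt_or_gt_of_ne hij with h | h
    · exact Set.Ioc_disjoint_Ioc_of_le (by exact_mod_cast h)
    · exact (Set.Ioc_disjoint_Ioc_of_le (by exact_mod_cast h)).symm
  let Z : Bool × ℤ → Ω → ℝ := fun p ω => ((bif p.1 then R ω else B ω) (cell p.2)).toReal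
  have hproc : ∀ b : Bool, IsPoissonProcess P lam fun ω => bif b then R ω else B ω := by
    rintro (_ | _)
    exacts [hB, hR]
  let μ : ℝ := ∫ ω, Z (false, 0) ω ∂P
  -- Centering does not affect alternating sums of even length, so the value of the mean is not
  -- needed.
  let X : ℕ → Ω → ℝ := fun n ω => Z (cellIndex n) ω - μ
  have hfin : ∀ k, volume (cell k) ≠ ∞ := fun k => by simp [vcell]
  have hL2 : ∀ p, MemLp (Z p) 2 P := fun p => (hproc p.1).memLp_two_toReal (mcell _) (hfin _)
  have hind : iIndepFun X P :=
    ((iIndepFun_apply_pair hR hB hRB mcell hd).comp (fun _ x => x.toReal - μ)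
      fun _ => by fun_prop).precomp cellIndex_injective
  have hmeas : ∀ n, Measurable (X n) := fun n =>
    (((hproc _).measurable_apply (mcell _)).ennreal_toReal).sub_const μ
  have hident : ∀ n, IdentDistrib (X n) (X 0) P P := fun n =>
    ((hproc (cellIndex n).1).identDistrib_toReal (hproc (cellIndex 0).1) (mcell _) (hfin _)
      (mcell _) (by rw [vcell, vcell])).comp (u := fun x => x - μ) (by fun_prop)
  have hX0 : X 0 = fun ω => Z (false, 0) ω - μ := by
    simp [X, cellIndex]
  have h2 : MemLp (X 0) 2 P := by
    rw [hX0]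
    exact (hL2 _).sub (memLp_const μ)
  have h0 : P[X 0] = 0 := by
    rw [hX0, integral_sub ((hL2 _).integrable (by norm_num)) (integrable_const _)]
    simp [μ]
  have hv : Var[X 0; P] ≠ 0 := by
    rw [hX0, variance_sub_const (hL2 _).aestronglyMeasurable]
    exact hB.variance_toReal_ne_zero hlam (mcell 0) (hfin 0) (by simp [vcell])
  filter_upwards [ae_exists_altSum_ge hind hmeas hident h2 h0 hv, hR.ae_countsAtoms,
    hB.ae_countsAtoms] with ω hω hcR hcB M K
  have hZR : ∀ k, Z (true, k) ω = cellCount (pointSet (R ω)) k := fun k => by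
    simp [Z, cell, (hcR k).2, cellCount]
  have hZB : ∀ k, Z (false, k) ω = cellCount (pointSet (B ω)) k := fun k => by
    simp [Z, cell, (hcB k).2, cellCount]
  have hX : ∀ k : ℕ, X (4 * k) ω = cellCount (pointSet (B ω)) k - μ ∧
      X (4 * k + 1) ω = cellCount (pointSet (R ω)) (-k - 1) - μ ∧
      X (4 * k + 2) ω = cellCount (pointSet (R ω)) k - μ ∧
      X (4 * k + 3) ω = cellCount (pointSet (B ω)) (-k - 1) - μ := by
    intro k
    have e0 : cellIndex (4 * k) = (false, (k : ℤ)) := by simp [cellIndex]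
    have e1 : cellIndex (4 * k + 1) = (true, -(k : ℤ) - 1) := by
      simp [cellIndex, show (4 * k + 1) / 4 = k by omega]
    have e2 : cellIndex (4 * k + 2) = (true, (k : ℤ)) := by
      simp [cellIndex, show (4 * k + 2) / 4 = k by omega]
    have e3 : cellIndex (4 * k + 3) = (false, -(k : ℤ) - 1) := by
      simp [cellIndex, show (4 * k + 3) / 4 = k by omega]
    simp only [X, e0, e1, e2, e3, hZR, hZB, and_self]
  -- The last term of a sum of `2 * n + 1` terms is a down-step, as in `le_walk_of_le_sum_cellCount`;
  -- `|μ|` makes up for its centering.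
  obtain ⟨L, hL, hωL⟩ := hω ⌈|(M : ℝ)| + |μ|⌉₊ ⌈K⌉₊
  refine ⟨L, (Nat.le_ceil K).trans (by exact_mod_cast hL), fun t ht1 ht2 => ?_⟩
  set n := ⌊|t|⌋₊ with hn
  have hLn : L ≤ n := Nat.le_floor ht1
  have hnL : n ≤ 4 * L := by
    have : (n : ℝ) ≤ (4 * L : ℕ) := by
      push_cast
      exact (Nat.floor_le (abs_nonneg t)).trans ht2
    exact_mod_cast this
  have hM := Nat.le_ceil (|(M : ℝ)| + |μ|)
  have key : ∀ s < 2, (M : ℝ) ≤ altSum (fun j => X (2 * j + s)) (2 * n + 1) ω - μ := by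
    intro s hs
    have := hωL s hs (2 * n + 1) (by omega) (by omega)
    linarith [le_abs_self (M : ℝ), le_abs_self μ]
  have hsum : ∀ s, altSum (fun j => X (2 * j + s)) (2 * n + 1) ω =
      ∑ k ∈ Finset.range n, (X (4 * k + 2 + s) ω - X (4 * k + s) ω) - X (4 * n + s) ω := by
    intro s
    rw [altSum_add, altSum_two_mul, ← Finset.sum_add_distrib]
    simp only [Finset.sum_range_one, add_zero]
    rw [show (-1 : ℝ) ^ (2 * n + 1) = -1 by simp [pow_succ, pow_mul]]
    rw [show 2 * (2 * n) + s = 4 * n + s by ring, neg_one_mul, sub_eq_add_neg]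
    congr 1
    refine Finset.sum_congr rfl fun k _ => ?_
    rw [show 2 * (2 * k + 1) + s = 4 * k + 2 + s by ring,
      show 2 * (2 * k) + s = 4 * k + s by ring, sub_eq_add_neg]
  apply le_walk_of_le_sum_cellCount (finite_pointSet_inter_Icc hcR)
    (finite_pointSet_inter_Icc hcB)
  · have h3 := key 0 (by norm_num)
    rw [hsum] at h3
    simp only [add_zero, (hX _).1, (hX _).2.2.1, sub_sub_sub_cancel_right,
      Finset.sum_sub_distrib] at h3
    rw [Finset.sum_range_succ]
    have h4 : (M : ℝ) + (∑ k ∈ Finset.range n, cellCount (pointSet (B ω)) k +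
        cellCount (pointSet (B ω)) n : ℕ) ≤
        (∑ k ∈ Finset.range n, cellCount (pointSet (R ω)) k : ℕ) := by
      push_cast
      linarith
    exact_mod_cast h4
  · have h3 := key 1 (by norm_num)
    rw [hsum] at h3
    simp only [add_assoc, Nat.reduceAdd, (hX _).2.1, (hX _).2.2.2, sub_sub_sub_cancel_right,
      Finset.sum_sub_distrib] at h3
    rw [Finset.sum_range_succ]
    have h4 : (M : ℝ) + (∑ k ∈ Finset.range n, cellCount (pointSet (R ω)) (-k - 1) +
        cellCount (pointSet (R ω)) (-n - 1) : ℕ) ≤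
        (∑ k ∈ Finset.range n, cellCount (pointSet (B ω)) (-k - 1) : ℕ) := by
      push_cast
      linarith
    exact_mod_cast h4

/-! ### The point sets of independent Poisson processes -/

theorem ae_wellSpread (hlam : 0 < lam) (hR : IsPoissonProcess P lam R)
    (hB : IsPoissonProcess P lam B) (hRB : IndepFun R B P) :
    ∀ᵐ ω ∂P, WellSpread (pointSet (R ω)) (pointSet (B ω)) := by
  filter_upwards [hR.ae_countsAtoms, hB.ae_countsAtoms, ae_disjoint_pointSet hR hB hRB,
    ae_no_tie hR hB hRB, ae_no_tie hB hR hRB.symm, ae_gap_right hR hB hRB, ae_gap_left hR hB hRB,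
    ae_exists_walk_ge hlam hR hB hRB, ae_exists_walk_ge hlam hB hR hRB.symm]
    with ω h1 h2 h3 h4 h5 h6 h7 h8 h9
  exact ⟨finite_pointSet_inter_Icc h1, finite_pointSet_inter_Icc h2, h3, h4, h5, h6, h7, h8, h9⟩

end Walk

theorem theorem1p2 {Ω : Type*} [MeasurableSpace Ω] (P : Measure Ω) [IsProbabilityMeasure P]
    (lam : ℝ≥0) (hlam : 0 < lam) (R B : Ω → Measure ℝ)
    (hR : IsPoissonProcess P lam R) (hB : IsPoissonProcess P lam B) (hRB : IndepFun R B P) :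
    ∀ᵐ ω ∂P,
      (∃! G : SimpleGraph ℝ, IsStableMultiMatching (pointSet (R ω)) (pointSet (B ω))
        (fun _ => 2) (fun _ => 2) G) ∧
      ∀ G : SimpleGraph ℝ, IsStableMultiMatching (pointSet (R ω)) (pointSet (B ω))
        (fun _ => 2) (fun _ => 2) G → ∀ c : G.ConnectedComponent, c.supp.Finite := by
  filter_upwards [ae_wellSpread hlam hR hB hRB] with ω hω
  exact hω.existsUnique_and_finite
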